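/- \textsc{Ext VC} is the following decision problem: given a finite simple undirected graph $G=(V,E)$ and a set $U\subseteq V$, does $G$ have an inclusionwise minimal vertex cover $S$ with $U\subseteq S$? A graph is subcubic if all its vertices have degree at most three. \textbf{Theorem.} \textsc{Ext VC} on subcubic graphs can be solved in time $\mathcal{O}^*(1.26^n)$ on graphs of order $n$. That is, there are a deterministic algorithm (a program of a unit-cost random access machine whose only arithmetic operations are successor and predecessor, with the adjacency matrix of $G$ and the characteristic vector of $U$ as its input) and a polynomial $p$ such that, for every $n\ge 0$, every subcubic graph $G$ with $n$ vertices and every set $U$ of vertices of $G$, the algorithm halts on input $(G,U)$ after at most $p(n)\cdot 1.26^n$ steps and correctly answers whether $G$ has a minimal vertex cover that contains $U$. -/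

import Mathlib

/-- `G` is subcubic: every vertex has degree at most three. -/
def IsSubcubic {V : Type*} (G : SimpleGraph V) : Prop :=
  ∀ v : V, (G.neighborSet v).encard ≤ 3

/-- The question of the problem Ext VC for the input `(G, U)`: does `G` have an inclusionwise
minimal vertex cover that contains `U`? -/
def ExtVC {V : Type*} (G : SimpleGraph V) (U : Set V) : Prop :=
  ∃ S : Set V, Minimal (fun C : Set V => G.IsVertexCover C) S ∧ U ⊆ S

/-! The machine model is the random access machine with unit cost and with successor and
predecessor as its only arithmetic operations (the "successor RAM"), presented with structured
control flow. The memory holds natural numbers, in variables and in two-dimensional arrays;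
array names are part of the program, array indices are computed at run time. A run of `t` steps
increases the largest number in the memory by at most `t`, up to a constant of the program,
so that unit cost does not hide any arithmetic on long numbers. -/

namespace RAM

/-- Memory contents: variable `x` holds `var x`, the entry `(i, j)` of array `a` is `arr a i j`. -/
@[ext]
structure Store where
  var : ℕ → ℕ
  arr : ℕ → ℕ → ℕ → ℕ

namespace Store

def setVar (σ : Store) (x v : ℕ) : Store where
  var := fun y => if y = x then v else σ.var y
  arr := σ.arr

def setCell (σ : Store) (a i j v : ℕ) : Store where
  var := σ.var
  arr := fun b k l => if b = a ∧ k = i ∧ l = j then v else σ.arr b k l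

end Store

/-- Expressions. -/
inductive Expr : Type
  | const (c : ℕ)
  | var (x : ℕ)
  | cell (a : ℕ) (i j : Expr)
  | succ (e : Expr)
  | pred (e : Expr)

namespace Expr

/-- The value of an expression; the predecessor of `0` is `0`. -/
def eval (σ : Store) : Expr → ℕ
  | const c => c
  | var x => σ.var x
  | cell a i j => σ.arr a (i.eval σ) (j.eval σ)
  | succ e => e.eval σ + 1
  | pred e => e.eval σ - 1

/-- The number of elementary operations in the evaluation of an expression. -/
def cost : Expr → ℕ
  | const _ => 1
  | var _ => 1
  | cell _ i j => i.cost + j.cost + 1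
  | succ e => e.cost + 1
  | pred e => e.cost + 1

end Expr

/-- Tests. -/
inductive Test : Type
  | eq (e f : Expr)
  | lt (e f : Expr)
  | not (b : Test)
  | and (b c : Test)

namespace Test

def Holds (σ : Store) : Test → Prop
  | eq e f => e.eval σ = f.eval σ
  | lt e f => e.eval σ < f.eval σ
  | not b => ¬ b.Holds σ
  | and b c => b.Holds σ ∧ c.Holds σ

/-- The number of elementary operations in the evaluation of a test. -/
def cost : Test → ℕ
  | eq e f => e.cost + f.cost + 1
  | lt e f => e.cost + f.cost + 1
  | not b => b.cost + 1
  | and b c => b.cost + c.cost + 1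

end Test

/-- Programs. -/
inductive Prog : Type
  | skip
  | setVar (x : ℕ) (e : Expr)
  | setCell (a : ℕ) (i j e : Expr)
  | seq (P Q : Prog)
  | ite (b : Test) (P Q : Prog)
  | loop (b : Test) (P : Prog)

/-- `Exec P σ τ t`: the program `P`, started with the memory contents `σ`, halts after exactly
`t` elementary steps with the memory contents `τ`. The construct `loop b P` is
"while `b` do `P`". -/
inductive Exec : Prog → Store → Store → ℕ → Prop
  | skip (σ : Store) : Exec .skip σ σ 1
  | setVar (x : ℕ) (e : Expr) (σ : Store) :
      Exec (.setVar x e) σ (σ.setVar x (e.eval σ)) (e.cost + 1)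
  | setCell (a : ℕ) (i j e : Expr) (σ : Store) :
      Exec (.setCell a i j e) σ (σ.setCell a (i.eval σ) (j.eval σ) (e.eval σ))
        (i.cost + j.cost + e.cost + 1)
  | seq {P Q : Prog} {σ τ ρ : Store} {s t : ℕ} :
      Exec P σ τ s → Exec Q τ ρ t → Exec (.seq P Q) σ ρ (s + t)
  | ite_true {b : Test} {P Q : Prog} {σ τ : Store} {t : ℕ} :
      b.Holds σ → Exec P σ τ t → Exec (.ite b P Q) σ τ (b.cost + t)
  | ite_false {b : Test} {P Q : Prog} {σ τ : Store} {t : ℕ} :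
      ¬ b.Holds σ → Exec Q σ τ t → Exec (.ite b P Q) σ τ (b.cost + t)
  | loop_true {b : Test} {P : Prog} {σ τ ρ : Store} {s t : ℕ} :
      b.Holds σ → Exec P σ τ s → Exec (.loop b P) τ ρ t →
      Exec (.loop b P) σ ρ (b.cost + s + t)
  | loop_false {b : Test} {P : Prog} {σ : Store} :
      ¬ b.Holds σ → Exec (.loop b P) σ σ b.cost

/-- Programs are deterministic: the final memory and the running time are determined by the
program and the initial memory. -/
theorem Exec.unique {P : Prog} {σ τ τ' : Store} {t t' : ℕ}
    (h : Exec P σ τ t) (h' : Exec P σ τ' t') : τ = τ' ∧ t = t' := by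
  induction h generalizing τ' t' with
  | skip σ => cases h'; exact ⟨rfl, rfl⟩
  | setVar x e σ => cases h'; exact ⟨rfl, rfl⟩
  | setCell a i j e σ => cases h'; exact ⟨rfl, rfl⟩
  | seq _ _ ih₁ ih₂ =>
    cases h' with
    | seq k₁ k₂ =>
      obtain ⟨rfl, rfl⟩ := ih₁ k₁
      obtain ⟨rfl, rfl⟩ := ih₂ k₂
      exact ⟨rfl, rfl⟩
  | ite_true hb _ ih =>
    cases h' with
    | ite_true _ k => obtain ⟨rfl, rfl⟩ := ih k; exact ⟨rfl, rfl⟩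
    | ite_false kb _ => exact absurd hb kb
  | ite_false hb _ ih =>
    cases h' with
    | ite_true kb _ => exact absurd kb hb
    | ite_false _ k => obtain ⟨rfl, rfl⟩ := ih k; exact ⟨rfl, rfl⟩
  | loop_true hb _ _ ih₁ ih₂ =>
    cases h' with
    | loop_true _ k₁ k₂ =>
      obtain ⟨rfl, rfl⟩ := ih₁ k₁
      obtain ⟨rfl, rfl⟩ := ih₂ k₂
      exact ⟨rfl, rfl⟩
    | loop_false kb => exact absurd hb kb
  | loop_false hb =>
    cases h' with
    | loop_true kb _ _ => exact absurd kb hb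
    | loop_false _ => exact ⟨rfl, rfl⟩

open Classical in
/-- The memory that presents a graph on the vertices `0, …, n - 1` with a vertex set `U`:
variable `0` holds `n`, array `0` holds the adjacency matrix, row `0` of array `1` holds the
characteristic vector of `U`, and everything else is `0`. -/
noncomputable def input {n : ℕ} (G : SimpleGraph (Fin n)) (U : Set (Fin n)) : Store where
  var := fun x => if x = 0 then n else 0
  arr := fun a i j =>
    if a = 0 ∧ ∃ u v : Fin n, u.val = i ∧ v.val = j ∧ G.Adj u v then 1
    else if a = 1 ∧ i = 0 ∧ ∃ u : Fin n, u.val = j ∧ u ∈ U then 1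
    else 0

end RAM

/-!
The minimal vertex covers of `G` are the complements of its maximal independent sets, so `U`
extends to a minimal vertex cover iff some independent set outside `U` dominates `U`
(`extVC_iff_solvable`). The search for such a set keeps a set `req` of vertices of `U` that are not
yet dominated and a set `free` of vertices that may still be chosen (`DomInst`).

Branching works as follows. Some free neighbor of each required vertex `u` is chosen. If `x` is
free, then `x` or one of those neighbors that dominate a required vertex not adjacent to `x` may be
assumed to be chosen, since otherwise the neighbors of `x` can be exchanged for `x`
(`DomInst.Solvable.exists_branch`). The search always uses one of these branching sets of the least
size `s`, which is at most `3` in a subcubic graph. The measure counts the required vertices and the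
free vertices with a required neighbor. Minimality of `s` makes it drop by at least `3 * (s - 1)`
in each branch (`DomInst.size_take_add_three_mul_le`).

A choice among `s` branches can be encoded by the number of ones among `s - 1` bits. Hence the whole
search consumes at most `n / 3` bits (`exists_bits`), and it can be made deterministic by trying all
`2 ^ (n / 3)` bit strings of that length, each of which takes polynomial time. As `2 ≤ 1.26 ^ 3`,
this is the asserted bound.

The program keeps the bit string as a binary counter in an array, so that no recursion stack is
needed. Its running time is controlled by a bound that is computed from the text of a program under
the assumption that no loop makes more than `n + 3` iterations (`RAM.Prog.bound`); only the outermost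
loop, over the bit strings, is treated separately (`RAM.exec_extVCProg`). What a piece of code leaves
unchanged is likewise read off from its text (`RAM.Exec.frame`).
-/

/-! ### Dominating instances and branching -/

section Branching

variable {V : Type*}

/-- An instance of the constrained domination problem to which `ExtVC` is reduced: find an
independent set of vertices from `free` that dominates all of `req`. -/
structure DomInst (V : Type*) where
  /-- the vertices still to be dominated -/
  req : Finset V
  /-- the vertices that may still be chosen -/
  free : Finset V

namespace DomInst

/-- There is an independent set inside `free` that dominates `req`. -/
def Solvable (G : SimpleGraph V) (S : DomInst V) : Prop :=
  ∃ I : Set V, (∀ x ∈ I, x ∈ S.free) ∧ (∀ x ∈ I, ∀ y ∈ I, ¬ G.Adj x y) ∧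
    ∀ u ∈ S.req, ∃ x ∈ I, G.Adj x u

open Classical in
/-- The instance that remains once `x` is put into the independent set. -/
noncomputable def take (G : SimpleGraph V) (S : DomInst V) (x : V) : DomInst V where
  req := S.req.filter fun u => ¬ G.Adj x u
  free := S.free.filter fun y => y ≠ x ∧ ¬ G.Adj x y

open Classical in
/-- The free vertices that dominate at least one required vertex. -/
noncomputable def useful (G : SimpleGraph V) (S : DomInst V) : Finset V :=
  S.free.filter fun v => ∃ u ∈ S.req, G.Adj v u

/-- The measure of the branching: useless free vertices do not count. -/
noncomputable def size (G : SimpleGraph V) (S : DomInst V) : ℕ :=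
  S.req.card + (S.useful G).card

/-- The vertices at which one may branch. -/
def Pivot (G : SimpleGraph V) (S : DomInst V) (v : V) : Prop :=
  v ∈ S.req ∨ v ∈ S.free ∧ ∃ u ∈ S.req, G.Adj v u

/-- `w` belongs to the branching set of `v`. For a required vertex `v` these are its free
neighbors. For a free vertex `v` these are `v` itself and those free neighbors that dominate a
required vertex which `v` does not dominate; other neighbors can always be exchanged for `v`. -/
def Branch (G : SimpleGraph V) (S : DomInst V) (v w : V) : Prop :=
  w ∈ S.free ∧ (v ∈ S.req ∧ G.Adj v w ∨
    v ∈ S.free ∧ (w = v ∨ G.Adj v w ∧ ∃ u ∈ S.req, G.Adj w u ∧ ¬ G.Adj v u))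

open Classical in
/-- The branching set of `v` as a finite set. -/
noncomputable def branchSet (G : SimpleGraph V) (S : DomInst V) (v : V) : Finset V :=
  S.free.filter (S.Branch G v)

variable {G : SimpleGraph V} {S : DomInst V} {u v w x : V}

theorem mem_branchSet : w ∈ S.branchSet G v ↔ S.Branch G v w := by
  simp only [branchSet, Finset.mem_filter, and_iff_right_iff_imp]
  exact fun h => h.1

theorem mem_useful : v ∈ S.useful G ↔ v ∈ S.free ∧ ∃ u ∈ S.req, G.Adj v u := by
  simp [useful]

theorem mem_take_req : u ∈ (S.take G x).req ↔ u ∈ S.req ∧ ¬ G.Adj x u := by simp [take]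

theorem mem_take_free : v ∈ (S.take G x).free ↔ v ∈ S.free ∧ v ≠ x ∧ ¬ G.Adj x v := by
  simp [take]

theorem Branch.mem_useful (hd : Disjoint S.req S.free) (hv : S.Pivot G v)
    (h : S.Branch G v w) : w ∈ S.useful G := by
  rw [DomInst.mem_useful]
  obtain ⟨hw, ⟨hr, ha⟩ | ⟨hf, rfl | ⟨-, u, hu, hwu, -⟩⟩⟩ := h
  · exact ⟨hw, v, hr, ha.symm⟩
  · obtain hv | ⟨-, u, hu, hwu⟩ := hv
    · exact absurd hw (Finset.disjoint_left.1 hd hv)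
    · exact ⟨hw, u, hu, hwu⟩
  · exact ⟨hw, u, hu, hwu⟩

theorem Solvable.of_take (hx : x ∈ S.free) (h : (S.take G x).Solvable G) : S.Solvable G := by
  obtain ⟨I, hI, hind, hdom⟩ := h
  refine ⟨insert x I, ?_, ?_, ?_⟩
  · rintro y (rfl | hy)
    · exact hx
    · exact (mem_take_free.1 (hI y hy)).1
  · rintro y (rfl | hy) z (rfl | hz)
    · exact G.loopless.irrefl _
    · exact (mem_take_free.1 (hI z hz)).2.2
    · exact fun h => (mem_take_free.1 (hI y hy)).2.2 h.symm
    · exact hind y hy z hz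
  · intro u hu
    by_cases hxu : G.Adj x u
    · exact ⟨x, Or.inl rfl, hxu⟩
    · obtain ⟨y, hy, hyu⟩ := hdom u (mem_take_req.2 ⟨hu, hxu⟩)
      exact ⟨y, Or.inr hy, hyu⟩

/-- Every solvable instance has a solution that meets the branching set of a given pivot: if a
solution misses the branching set of a free vertex `v`, exchange the neighbors of `v` for `v`. -/
theorem Solvable.exists_branch (hv : S.Pivot G v) (h : S.Solvable G) :
    ∃ w, S.Branch G v w ∧ (S.take G w).Solvable G := by
  suffices H : ∃ I : Set V, (∀ x ∈ I, x ∈ S.free) ∧ (∀ x ∈ I, ∀ y ∈ I, ¬ G.Adj x y) ∧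
      (∀ u ∈ S.req, ∃ x ∈ I, G.Adj x u) ∧ ∃ w ∈ I, S.Branch G v w by
    obtain ⟨I, hI, hind, hdom, w, hw, hb⟩ := H
    refine ⟨w, hb, I \ {w}, ?_, fun x hx y hy => hind x hx.1 y hy.1, ?_⟩
    · rintro x ⟨hx, hxw⟩
      exact mem_take_free.2 ⟨hI x hx, hxw, hind w hw x hx⟩
    · intro u hu
      obtain ⟨hu, hwu⟩ := mem_take_req.1 hu
      obtain ⟨x, hx, hxu⟩ := hdom u hu
      exact ⟨x, ⟨hx, by rintro rfl; exact hwu hxu⟩, hxu⟩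
  obtain ⟨I, hI, hind, hdom⟩ := h
  by_cases hm : ∃ w ∈ I, S.Branch G v w
  · exact ⟨I, hI, hind, hdom, hm⟩
  push Not at hm
  obtain hv | ⟨hv, -⟩ := hv
  · obtain ⟨x, hx, hxv⟩ := hdom v hv
    exact absurd ⟨hI x hx, Or.inl ⟨hv, hxv.symm⟩⟩ (hm x hx)
  refine ⟨{v} ∪ {x ∈ I | ¬ G.Adj v x}, ?_, ?_, ?_, v, Or.inl rfl, hv, Or.inr ⟨hv, Or.inl rfl⟩⟩
  · rintro x (rfl | hx)
    · exact hv
    · exact hI x hx.1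
  · rintro x (rfl | hx) y (rfl | hy)
    · exact G.loopless.irrefl _
    · exact hy.2
    · exact fun h => hx.2 h.symm
    · exact hind x hx.1 y hy.1
  · intro u hu
    by_cases hvu : G.Adj v u
    · exact ⟨v, Or.inl rfl, hvu⟩
    obtain ⟨x, hx, hxu⟩ := hdom u hu
    refine ⟨x, Or.inr ⟨hx, fun hvx => hm x hx ?_⟩, hxu⟩
    exact ⟨hI x hx, Or.inr ⟨hv, Or.inr ⟨hvx, u, hu, hxu, hvu⟩⟩⟩

theorem useful_take_subset : (S.take G x).useful G ⊆ S.useful G := by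
  intro v hv
  rw [mem_useful, mem_take_free] at hv
  obtain ⟨⟨hv, -⟩, u, hu, hvu⟩ := hv
  exact mem_useful.2 ⟨hv, u, (mem_take_req.1 hu).1, hvu⟩

/-- To bound the decrease of the measure, it suffices to exhibit one dominated required vertex and a
set `D` of useful vertices that cease to be useful. -/
theorem size_take_add_le (hu : u ∈ S.req) (hxu : G.Adj x u) {D : Finset V}
    (hD : D ⊆ S.useful G) (hdisj : ∀ y ∈ D, y ∉ (S.take G x).useful G) :
    (S.take G x).size G + (1 + D.card) ≤ S.size G := by
  classical
  have h1 : (S.take G x).req.card + 1 ≤ S.req.card := by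
    refine Finset.card_lt_card (Finset.ssubset_iff_of_subset ?_ |>.2 ⟨u, hu, ?_⟩)
    · exact fun y hy => (mem_take_req.1 hy).1
    · exact fun h => (mem_take_req.1 h).2 hxu
  have h2 : ((S.take G x).useful G).card + D.card ≤ (S.useful G).card := by
    rw [← Finset.card_union_of_disjoint]
    · exact Finset.card_le_card (Finset.union_subset useful_take_subset hD)
    · exact Finset.disjoint_left.2 fun y hy hyD => hdisj y hyD hy
  unfold size
  omega

theorem size_take_lt (hx : x ∈ S.useful G) : (S.take G x).size G < S.size G := by
  obtain ⟨-, u, hu, hxu⟩ := mem_useful.1 hx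
  have := size_take_add_le hu hxu (Finset.empty_subset _) (by simp)
  simp at this
  omega

theorem card_le_three_of_adj (hG : IsSubcubic G) {T : Finset V} (hT : ∀ w ∈ T, G.Adj v w) :
    T.card ≤ 3 := by
  have h : (T : Set V).encard ≤ 3 := (Set.encard_le_encard fun w hw => hT w hw).trans (hG v)
  rw [Set.encard_coe_eq_coe_finsetCard] at h
  exact_mod_cast h

theorem card_branchSet_le_three (hG : IsSubcubic G) (hd : Disjoint S.req S.free)
    (hv : v ∈ S.req) : (S.branchSet G v).card ≤ 3 := by
  refine card_le_three_of_adj hG (v := v) fun w hw => ?_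
  obtain ⟨-, h | h⟩ := mem_branchSet.1 hw
  · exact h.2
  · exact absurd h.1 (Finset.disjoint_left.1 hd hv)

/-- The members of the branching set of a free vertex `x`, apart from `x` itself. -/
theorem mem_branchSet_erase [DecidableEq V] (hd : Disjoint S.req S.free) (hx : x ∈ S.free)
    (hw : w ∈ (S.branchSet G x).erase x) :
    w ∈ S.free ∧ G.Adj x w ∧ ∃ u ∈ S.req, G.Adj w u ∧ ¬ G.Adj x u := by
  obtain ⟨hne, hw⟩ := Finset.mem_erase.1 hw
  obtain ⟨hwf, h | ⟨-, h | h⟩⟩ := mem_branchSet.1 hw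
  · exact absurd hx (Finset.disjoint_left.1 hd h.1)
  · exact absurd h hne
  · exact ⟨hwf, h⟩

/-- A free vertex whose branching set has three elements has two free neighbors, hence at most
one required neighbor. -/
theorem eq_of_adj_of_three_le_card (hG : IsSubcubic G) (hd : Disjoint S.req S.free)
    (hx : x ∈ S.free) (h3 : 3 ≤ (S.branchSet G x).card) (hu : u ∈ S.req) (hxu : G.Adj x u)
    (hv : v ∈ S.req) (hxv : G.Adj x v) : u = v := by
  classical
  by_contra hne
  have hE : ∀ w ∈ (S.branchSet G x).erase x, w ∈ S.free ∧ G.Adj x w := fun w hw =>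
    ⟨(mem_branchSet_erase hd hx hw).1, (mem_branchSet_erase hd hx hw).2.1⟩
  have hc : 2 ≤ ((S.branchSet G x).erase x).card := by
    have := Finset.pred_card_le_card_erase (s := S.branchSet G x) (a := x)
    omega
  have h4 : (({u, v} : Finset V) ∪ (S.branchSet G x).erase x).card ≤ 3 := by
    refine card_le_three_of_adj hG (v := x) fun w hw => ?_
    simp only [Finset.mem_union, Finset.mem_insert, Finset.mem_singleton] at hw
    obtain (rfl | rfl) | hw := hw
    exacts [hxu, hxv, (hE w hw).2]
  rw [Finset.card_union_of_disjoint, Finset.card_pair hne] at h4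
  · omega
  · refine Finset.disjoint_left.2 fun w hw hw' => ?_
    simp only [Finset.mem_insert, Finset.mem_singleton] at hw
    obtain rfl | rfl := hw
    · exact Finset.disjoint_left.1 hd hu (hE _ hw').1
    · exact Finset.disjoint_left.1 hd hv (hE _ hw').1

/-- If all branching sets have at least `s ≤ 3` elements, then choosing any useful vertex lowers
the measure by at least `3 * (s - 1)`. For `s = 2` the vertex `x`, a neighbor that blocks it, and
a required neighbor disappear. For `s = 3` the useful vertices have exactly one required and two
free neighbors, so that `x`, its three neighbors and the two other neighbors of its required
neighbor disappear, and these six vertices are distinct. -/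
theorem size_take_add_three_mul_le (hG : IsSubcubic G) (hd : Disjoint S.req S.free) {s : ℕ}
    (hs1 : 1 ≤ s) (hs3 : s ≤ 3) (hs : ∀ v, S.Pivot G v → s ≤ (S.branchSet G v).card)
    (hx : x ∈ S.useful G) : (S.take G x).size G + 3 * (s - 1) ≤ S.size G := by
  classical
  obtain ⟨hxf, u, hu, hxu⟩ := mem_useful.1 hx
  have hxc := hs x (Or.inr ⟨hxf, u, hu, hxu⟩)
  have hxx : x ∉ (S.take G x).useful G := fun h => (mem_take_free.1 (mem_useful.1 h).1).2.1 rfl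
  have hE : ∀ w ∈ (S.branchSet G x).erase x,
      w ∈ S.useful G ∧ w ∉ (S.take G x).useful G := fun w hw => by
    obtain ⟨hwf, hxw, v, hv, hwv, -⟩ := mem_branchSet_erase hd hxf hw
    exact ⟨mem_useful.2 ⟨hwf, v, hv, hwv⟩,
      fun h => (mem_take_free.1 (mem_useful.1 h).1).2.2 hxw⟩
  have hcE := Finset.pred_card_le_card_erase (s := S.branchSet G x) (a := x)
  obtain rfl | rfl | rfl : s = 1 ∨ s = 2 ∨ s = 3 := by omega
  · exact (size_take_lt hx).le
  · have := size_take_add_le hu hxu (D := insert x ((S.branchSet G x).erase x))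
      (Finset.insert_subset hx fun w hw => (hE w hw).1) (by
        intro y hy
        obtain rfl | hy := Finset.mem_insert.1 hy
        exacts [hxx, (hE y hy).2])
    rw [Finset.card_insert_of_notMem (Finset.notMem_erase _ _)] at this
    omega
  · have huc := hs u (Or.inl hu)
    have hU : ∀ w ∈ S.branchSet G u, w ∈ S.useful G ∧ G.Adj w u := fun w hw => by
      obtain ⟨hwf, h | h⟩ := mem_branchSet.1 hw
      · exact ⟨mem_useful.2 ⟨hwf, u, hu, h.2.symm⟩, h.2.symm⟩
      · exact absurd h.1 (Finset.disjoint_left.1 hd hu)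
    have hone : ∀ w ∈ S.useful G, ∀ v ∈ S.req, G.Adj w v → ∀ v' ∈ S.req, G.Adj w v' → v = v' :=
      fun w hw v hv hwv v' hv' hwv' =>
        eq_of_adj_of_three_le_card hG hd (mem_useful.1 hw).1
          (hs w (Or.inr (mem_useful.1 hw))) hv hwv hv' hwv'
    have := size_take_add_le hu hxu (D := S.branchSet G u ∪ (S.branchSet G x).erase x)
      (Finset.union_subset (fun w hw => (hU w hw).1) fun w hw => (hE w hw).1) (by
        intro y hy hyt
        obtain hy | hy := Finset.mem_union.1 hy
        · obtain ⟨-, v, hv, hyv⟩ := mem_useful.1 hyt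
          obtain ⟨hv, hxv⟩ := mem_take_req.1 hv
          obtain rfl := hone y (hU y hy).1 u hu (hU y hy).2 v hv hyv
          exact hxv hxu
        · exact (hE y hy).2 hyt)
    rw [Finset.card_union_of_disjoint] at this
    · omega
    · refine Finset.disjoint_left.2 fun w hw hw' => ?_
      obtain ⟨hwf, hxw, v, hv, hwv, hxv⟩ := mem_branchSet_erase hd hxf hw'
      obtain rfl := hone w (hU w hw).1 u hu (hU w hw).2 v hv hwv
      exact hxv hxu

end DomInst

end Branching

/-! ### Programs with a time bound that is read off from their text -/

namespace RAM

/-- A bound on the running time of `P` that is valid if each execution of a loop inside `P`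
makes at most `n + 3` iterations. -/
def Prog.bound (n : ℕ) : Prog → ℕ
  | .skip => 1
  | .setVar _ e => e.cost + 1
  | .setCell _ i j e => i.cost + j.cost + e.cost + 1
  | .seq P Q => P.bound n + Q.bound n
  | .ite b P Q => b.cost + (P.bound n + Q.bound n)
  | .loop b P => (n + 3) * (b.cost + P.bound n) + b.cost

theorem Prog.exists_polynomial_bound (P : Prog) :
    ∃ p : Polynomial ℕ, ∀ n, P.bound n = p.eval n := by
  induction P with
  | skip => exact ⟨1, fun n => by simp [bound]⟩
  | setVar x e => exact ⟨.C (e.cost + 1), fun n => by simp [bound]⟩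
  | setCell a i j e => exact ⟨.C (i.cost + j.cost + e.cost + 1), fun n => by simp [bound]⟩
  | seq P Q ihP ihQ =>
    obtain ⟨p, hp⟩ := ihP
    obtain ⟨q, hq⟩ := ihQ
    exact ⟨p + q, fun n => by simp [bound, hp, hq]⟩
  | ite b P Q ihP ihQ =>
    obtain ⟨p, hp⟩ := ihP
    obtain ⟨q, hq⟩ := ihQ
    exact ⟨.C b.cost + (p + q), fun n => by simp [bound, hp, hq]⟩
  | loop b P ih =>
    obtain ⟨p, hp⟩ := ih
    exact ⟨(.X + .C 3) * (.C b.cost + p) + .C b.cost, fun n => by simp [bound, hp]⟩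

/-- `P` may change variable `x`. -/
def Prog.writesVar (x : ℕ) : Prog → Bool
  | .skip => false
  | .setVar y _ => x == y
  | .setCell _ _ _ _ => false
  | .seq P Q => P.writesVar x || Q.writesVar x
  | .ite _ P Q => P.writesVar x || Q.writesVar x
  | .loop _ P => P.writesVar x

/-- `P` may change array `a`. -/
def Prog.writesArr (a : ℕ) : Prog → Bool
  | .skip => false
  | .setVar _ _ => false
  | .setCell b _ _ _ => a == b
  | .seq P Q => P.writesArr a || Q.writesArr a
  | .ite _ P Q => P.writesArr a || Q.writesArr a
  | .loop _ P => P.writesArr a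

/-- `τ` agrees with `σ` on everything that `P` does not write. -/
structure Frame (P : Prog) (σ τ : Store) : Prop where
  var : ∀ x, P.writesVar x = false → τ.var x = σ.var x
  arr : ∀ a, P.writesArr a = false → τ.arr a = σ.arr a

theorem Exec.frame {P : Prog} {σ τ : Store} {t : ℕ} (h : Exec P σ τ t) : Frame P σ τ := by
  induction h with
  | skip σ => exact ⟨fun _ _ => rfl, fun _ _ => rfl⟩
  | setVar x e σ =>
    refine ⟨fun y hy => ?_, fun _ _ => rfl⟩
    simp only [Prog.writesVar, beq_eq_false_iff_ne] at hy
    simp [Store.setVar, hy]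
  | setCell a i j e σ =>
    refine ⟨fun _ _ => rfl, fun b hb => ?_⟩
    simp only [Prog.writesArr, beq_eq_false_iff_ne] at hb
    simp [Store.setCell, hb]
  | seq _ _ ih₁ ih₂ =>
    refine ⟨fun y hy => ?_, fun b hb => ?_⟩
    · simp only [Prog.writesVar, Bool.or_eq_false_iff] at hy
      rw [ih₂.var y hy.2, ih₁.var y hy.1]
    · simp only [Prog.writesArr, Bool.or_eq_false_iff] at hb
      rw [ih₂.arr b hb.2, ih₁.arr b hb.1]
  | ite_true _ _ ih =>
    refine ⟨fun y hy => ?_, fun b hb => ?_⟩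
    · simp only [Prog.writesVar, Bool.or_eq_false_iff] at hy
      exact ih.var y hy.1
    · simp only [Prog.writesArr, Bool.or_eq_false_iff] at hb
      exact ih.arr b hb.1
  | ite_false _ _ ih =>
    refine ⟨fun y hy => ?_, fun b hb => ?_⟩
    · simp only [Prog.writesVar, Bool.or_eq_false_iff] at hy
      exact ih.var y hy.2
    · simp only [Prog.writesArr, Bool.or_eq_false_iff] at hb
      exact ih.arr b hb.2
  | loop_true _ _ _ ih₁ ih₂ =>
    exact ⟨fun y hy => (ih₂.var y hy).trans (ih₁.var y hy),
      fun b hb => (ih₂.arr b hb).trans (ih₁.arr b hb)⟩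
  | loop_false _ => exact ⟨fun _ _ => rfl, fun _ _ => rfl⟩

/-- Started in `σ`, the program `P` halts within its time bound for `n`, in a store that
satisfies `Q`. -/
def Run (n : ℕ) (P : Prog) (Q : Store → Prop) (σ : Store) : Prop :=
  ∃ τ t, Exec P σ τ t ∧ t ≤ P.bound n ∧ Q τ

namespace Run

variable {n : ℕ} {P P' : Prog} {Q R : Store → Prop} {σ : Store}

theorem mono (h : Run n P Q σ) (hQ : ∀ τ, Q τ → Frame P σ τ → R τ) : Run n P R σ := by
  obtain ⟨τ, t, he, ht, hq⟩ := h
  exact ⟨τ, t, he, ht, hQ τ hq he.frame⟩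

theorem skip (h : Q σ) : Run n .skip Q σ := ⟨σ, 1, .skip σ, le_rfl, h⟩

theorem setVar {x : ℕ} {e : Expr} (h : Q (σ.setVar x (e.eval σ))) :
    Run n (.setVar x e) Q σ := ⟨_, _, .setVar x e σ, le_rfl, h⟩

theorem setCell {a : ℕ} {i j e : Expr} (h : Q (σ.setCell a (i.eval σ) (j.eval σ) (e.eval σ))) :
    Run n (.setCell a i j e) Q σ := ⟨_, _, .setCell a i j e σ, le_rfl, h⟩

theorem seq (h : Run n P (Run n P' Q) σ) : Run n (.seq P P') Q σ := by
  obtain ⟨τ, s, he, hs, ρ, t, he', ht, hq⟩ := h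
  exact ⟨ρ, s + t, he.seq he', Nat.add_le_add hs ht, hq⟩

theorem ite {b : Test} (h : b.Holds σ → Run n P Q σ) (h' : ¬ b.Holds σ → Run n P' Q σ) :
    Run n (.ite b P P') Q σ := by
  by_cases hb : b.Holds σ
  · obtain ⟨τ, t, he, ht, hq⟩ := h hb
    exact ⟨τ, _, .ite_true hb he, by simp only [Prog.bound]; omega, hq⟩
  · obtain ⟨τ, t, he, ht, hq⟩ := h' hb
    exact ⟨τ, _, .ite_false hb he, by simp only [Prog.bound]; omega, hq⟩

/-- Loops with an invariant and a known number `m` of iterations. -/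
theorem exists_exec_loop {b : Test} {T m : ℕ} {Inv : ℕ → Store → Prop} (h0 : Inv 0 σ)
    (hstep : ∀ i < m, ∀ τ, Inv i τ →
      b.Holds τ ∧ ∃ ρ t, Exec P τ ρ t ∧ t ≤ T ∧ Inv (i + 1) ρ)
    (hend : ∀ τ, Inv m τ → ¬ b.Holds τ) :
    ∃ τ t, Exec (.loop b P) σ τ t ∧ t ≤ m * (b.cost + T) + b.cost ∧ Inv m τ := by
  induction m generalizing Inv σ with
  | zero => exact ⟨σ, _, .loop_false (hend σ h0), by simp, h0⟩
  | succ m ih =>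
    obtain ⟨hb, ρ, t, he, ht, hi⟩ := hstep 0 (Nat.succ_pos m) σ h0
    obtain ⟨τ, s, he', hs, hi'⟩ := ih (Inv := fun i => Inv (i + 1)) hi
      (fun i hi => hstep (i + 1) (Nat.succ_lt_succ hi)) hend
    exact ⟨τ, _, .loop_true hb he he', by rw [Nat.succ_mul]; omega, hi'⟩

theorem loop {b : Test} {m : ℕ} (hm : m ≤ n + 3) (Inv : ℕ → Store → Prop) (h0 : Inv 0 σ)
    (hstep : ∀ i < m, ∀ τ, Inv i τ → b.Holds τ ∧ Run n P (Inv (i + 1)) τ)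
    (hend : ∀ τ, Inv m τ → ¬ b.Holds τ) : Run n (.loop b P) (Inv m) σ := by
  obtain ⟨τ, t, he, ht, hi⟩ := exists_exec_loop (T := P.bound n) h0 hstep hend
  exact ⟨τ, t, he, ht.trans (Nat.add_le_add_right (Nat.mul_le_mul_right _ hm) _), hi⟩

end Run

/-- Disjunction of tests. -/
def Test.or (b c : Test) : Test := .not (.and (.not b) (.not c))

@[simp]
theorem Test.holds_or {σ : Store} {b c : Test} : (b.or c).Holds σ ↔ b.Holds σ ∨ c.Holds σ := by
  simp only [Test.or, Test.Holds]
  tauto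

/-- `for x < n do P`, where variable `0` holds `n`. -/
def forUp (x : ℕ) (P : Prog) : Prog :=
  .seq (.setVar x (.const 0))
    (.loop (.lt (.var x) (.var 0)) (.seq P (.setVar x (.succ (.var x)))))

/-- The rule for counting loops: the body may rely on everything that it does not write. -/
theorem Run.forUp {n x : ℕ} {P : Prog} {σ : Store} (Inv : ℕ → Store → Prop)
    (hn : σ.var 0 = n) (hx : (x == 0) = false) (hP0 : P.writesVar 0 = false)
    (hPx : P.writesVar x = false)
    (h0 : Inv 0 (σ.setVar x 0))
    (hstep : ∀ i < n, ∀ τ, τ.var x = i → Frame (forUp x P) σ τ → Inv i τ →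
      Run n P (fun ρ => Inv (i + 1) (ρ.setVar x (i + 1))) τ) :
    Run n (forUp x P) (Inv n) σ := by
  have hx0 : x ≠ 0 := by simpa using hx
  have hfr : ∀ τ, Frame P σ τ → ∀ k, Frame (RAM.forUp x P) σ (τ.setVar x k) := by
    refine fun τ h k => ⟨fun y hy => ?_, fun a ha => ?_⟩
    · simp only [RAM.forUp, Prog.writesVar, Bool.or_eq_false_iff, beq_eq_false_iff_ne] at hy
      simpa [Store.setVar, hy.1] using h.var y hy.2.1
    · simp only [RAM.forUp, Prog.writesArr, Bool.or_eq_false_iff] at ha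
      exact h.arr a ha.2.1
  refine .seq (.setVar ?_)
  refine (Run.loop (m := n) (by omega)
    (fun i τ => (τ.var x = i ∧ Frame (RAM.forUp x P) σ τ) ∧ Inv i τ) ?_ ?_ ?_).mono
    fun τ h _ => h.2
  · exact ⟨⟨by simp [Store.setVar, Expr.eval],
      hfr σ ⟨fun _ _ => rfl, fun _ _ => rfl⟩ 0⟩, h0⟩
  · rintro i hi τ ⟨⟨hxi, hf⟩, hinv⟩
    have hτ0 : τ.var 0 = n := by
      rw [hf.var 0, hn]
      simp [RAM.forUp, Prog.writesVar, hP0, hx0.symm]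
    refine ⟨by simpa [Test.Holds, Expr.eval, hxi, hτ0] using hi, .seq ?_⟩
    refine (hstep i hi τ hxi hf hinv).mono fun ρ hρ hρf => .setVar ?_
    have hρx : ρ.var x = i := by rw [hρf.var x hPx, hxi]
    simp only [Expr.eval, hρx]
    refine ⟨⟨by simp [Store.setVar], ?_⟩, hρ⟩
    refine ⟨fun y hy => ?_, fun a ha => ?_⟩
    · rw [← hf.var y hy]
      simp only [RAM.forUp, Prog.writesVar, Bool.or_eq_false_iff, beq_eq_false_iff_ne] at hy
      simpa [Store.setVar, hy.1] using hρf.var y hy.2.1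
    · rw [← hf.arr a ha]
      simp only [RAM.forUp, Prog.writesArr, Bool.or_eq_false_iff] at ha
      exact hρf.arr a ha.2.1
  · rintro τ ⟨⟨hxi, hf⟩, -⟩
    have hτ0 : τ.var 0 = n := by
      rw [hf.var 0, hn]
      simp [RAM.forUp, Prog.writesVar, hP0, hx0.symm]
    simp [Test.Holds, Expr.eval, hxi, hτ0]

end RAM

/-! ### The search, directed by a string of bits -/

namespace DomInst

/-- All vertices of the instance are below `n`, and no vertex is both required and free. -/
structure Bounded (n : ℕ) (S : DomInst ℕ) : Prop where
  req_lt : ∀ v ∈ S.req, v < n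
  free_lt : ∀ v ∈ S.free, v < n
  disj : Disjoint S.req S.free

variable {G : SimpleGraph ℕ} {n : ℕ} {S : DomInst ℕ}

theorem Bounded.take (h : S.Bounded n) (x : ℕ) : (S.take G x).Bounded n where
  req_lt v hv := h.req_lt v (mem_take_req.1 hv).1
  free_lt v hv := h.free_lt v (mem_take_free.1 hv).1
  disj := Finset.disjoint_left.2 fun _ hv hv' =>
    Finset.disjoint_left.1 h.disj (mem_take_req.1 hv).1 (mem_take_free.1 hv').1

open Classical in
/-- The number of elements below `n` of the branching set of `v`. -/
noncomputable def branchCount (G : SimpleGraph ℕ) (n : ℕ) (S : DomInst ℕ) (v : ℕ) : ℕ :=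
  Nat.count (S.Branch G v) n

theorem Bounded.branchCount_eq (h : S.Bounded n) (v : ℕ) :
    S.branchCount G n v = (S.branchSet G v).card := by
  classical
  rw [branchCount, Nat.count_eq_card_filter_range]
  congr 1
  ext w
  simp only [Finset.mem_filter, Finset.mem_range, mem_branchSet, and_iff_right_iff_imp]
  exact fun hw => h.free_lt w hw.1

end DomInst

open Classical in
/-- The least value of `c` below `4` on the elements of `e` below `k`, together with the first
place where it is attained; `(4, 0)` if there is no such value. The bound `4` exceeds the sizes of
the branching sets that matter in subcubic graphs. -/
noncomputable def argminBelow (e : ℕ → Prop) (c : ℕ → ℕ) : ℕ → ℕ × ℕ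
  | 0 => (4, 0)
  | k + 1 =>
    if e k ∧ c k < (argminBelow e c k).1 then (c k, k) else argminBelow e c k

theorem argminBelow_spec (e : ℕ → Prop) (c : ℕ → ℕ) (k : ℕ) :
    ((argminBelow e c k).1 < 4 →
      e (argminBelow e c k).2 ∧ c (argminBelow e c k).2 = (argminBelow e c k).1) ∧
    ∀ v < k, e v → (argminBelow e c k).1 ≤ c v := by
  induction k with
  | zero => simp [argminBelow]
  | succ k ih =>
    rw [argminBelow]
    split_ifs with h
    · refine ⟨fun _ => ⟨h.1, rfl⟩, fun v hv he => ?_⟩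
      obtain hv | rfl := Nat.lt_succ_iff_lt_or_eq.1 hv
      · exact h.2.le.trans (ih.2 v hv he)
      · exact le_rfl
    · refine ⟨ih.1, fun v hv he => ?_⟩
      obtain hv | rfl := Nat.lt_succ_iff_lt_or_eq.1 hv
      · exact ih.2 v hv he
      · exact not_lt.1 fun hlt => h ⟨he, hlt⟩

open Classical in
/-- One round of the search. The second component is the number of bits of `β` that have been
consumed. A branching set of the least size `s` is selected; the next `s - 1` bits are consumed,
and if `j` of them are `1`, then the `j`-th element of the branching set is taken. -/
noncomputable def searchRound (G : SimpleGraph ℕ) (n : ℕ) (β : ℕ → Bool)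
    (X : DomInst ℕ × ℕ) : DomInst ℕ × ℕ :=
  if 0 < (argminBelow (X.1.Pivot G) (X.1.branchCount G n) n).1 ∧
      (argminBelow (X.1.Pivot G) (X.1.branchCount G n) n).1 < 4 then
    (X.1.take G (Nat.nth
        (X.1.Branch G (argminBelow (X.1.Pivot G) (X.1.branchCount G n) n).2)
        (Nat.count (fun i => β (X.2 + i) = true)
          ((argminBelow (X.1.Pivot G) (X.1.branchCount G n) n).1 - 1))),
      X.2 + ((argminBelow (X.1.Pivot G) (X.1.branchCount G n) n).1 - 1))
  else X

theorem nth_mem_of_lt_count {p : ℕ → Prop} [DecidablePred p] {j n : ℕ} (h : j < Nat.count p n) :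
    p (Nat.nth p j) :=
  Nat.nth_mem _ fun hf => h.trans_le (Nat.count_le_card hf n)

section SearchRound

variable {G : SimpleGraph ℕ} {n : ℕ} {β : ℕ → Bool} {X : DomInst ℕ × ℕ}

open DomInst

/-- Unless a round of the search changes nothing, it takes an element of a branching set. -/
theorem searchRound_eq (G : SimpleGraph ℕ) (n : ℕ) (β : ℕ → Bool) (X : DomInst ℕ × ℕ) :
    searchRound G n β X = X ∨
      ∃ v w, X.1.Pivot G v ∧ X.1.Branch G v w ∧ (searchRound G n β X).1 = X.1.take G w := by
  classical
  unfold searchRound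
  split_ifs with h
  · obtain ⟨hp, hc⟩ := (argminBelow_spec (X.1.Pivot G) (X.1.branchCount G n) n).1 h.2
    refine Or.inr ⟨_, _, hp, nth_mem_of_lt_count (n := n) ?_, rfl⟩
    rw [branchCount] at hc
    rw [hc]
    exact (Nat.count_le _).trans_lt (by omega)
  · exact Or.inl rfl

theorem DomInst.Bounded.searchRound (h : X.1.Bounded n) : (searchRound G n β X).1.Bounded n := by
  obtain he | ⟨v, w, -, -, he⟩ := searchRound_eq G n β X
  · rwa [he]
  · rw [he]
    exact h.take w

theorem solvable_of_searchRound (h : (searchRound G n β X).1.Solvable G) : X.1.Solvable G := by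
  obtain he | ⟨v, w, -, hw, he⟩ := searchRound_eq G n β X
  · rwa [he] at h
  · rw [he] at h
    exact h.of_take hw.1

/-- Soundness of the search: success with any bit string yields a solution. -/
theorem solvable_of_search {m : ℕ} (h : ((searchRound G n β)^[m] X).1.req = ∅) :
    X.1.Solvable G := by
  induction m generalizing X with
  | zero => exact ⟨∅, by simp, by simp, by simp_all⟩
  | succ m ih => exact solvable_of_searchRound (ih h)

theorem searchRound_req_subset : (searchRound G n β X).1.req ⊆ X.1.req := by
  obtain he | ⟨v, w, -, -, he⟩ := searchRound_eq G n β X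
  · rw [he]
  · rw [he]
    exact fun u hu => (mem_take_req.1 hu).1

theorem search_req_eq_empty {m : ℕ} (h : X.1.req = ∅) :
    ((searchRound G n β)^[m] X).1.req = ∅ := by
  induction m generalizing X with
  | zero => exact h
  | succ m ih => exact ih (Finset.subset_empty.1 (h ▸ searchRound_req_subset))

/-- In a solvable instance some choice of the next bits makes a round of the search preserve
solvability, and each consumed bit is paid for by a decrease of the measure by three. -/
theorem exists_searchRound_solvable (hG : IsSubcubic G) (hX : X.1.Bounded n)
    (hsol : X.1.Solvable G) (hreq : X.1.req.Nonempty) :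
    ∃ s j, j ≤ s ∧ ∃ Y : DomInst ℕ, Y.Solvable G ∧ Y.Bounded n ∧ Y.size G < X.1.size G ∧
      Y.size G + 3 * s ≤ X.1.size G ∧
      ∀ β : ℕ → Bool, (∀ i < s, β (X.2 + i) = decide (i < j)) →
        searchRound G n β X = (Y, X.2 + s) := by
  classical
  obtain ⟨hb, hmin⟩ := argminBelow_spec (X.1.Pivot G) (X.1.branchCount G n) n
  set b := argminBelow (X.1.Pivot G) (X.1.branchCount G n) n with hbdef
  have hmin' : ∀ v, X.1.Pivot G v → b.1 ≤ (X.1.branchSet G v).card := fun v hv => by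
    rw [← hX.branchCount_eq]
    exact hmin v (hv.elim (hX.req_lt v) fun h => hX.free_lt v h.1) hv
  obtain ⟨u, hu⟩ := hreq
  have hb4 : b.1 < 4 := Nat.lt_succ_of_le
    ((hmin' u (Or.inl hu)).trans (card_branchSet_le_three hG hX.disj hu))
  obtain ⟨hp, hc⟩ := hb hb4
  obtain ⟨w, hw, hws⟩ := hsol.exists_branch hp
  have hwc : Nat.count (X.1.Branch G b.2) w < b.1 := by
    rw [← hc]
    exact Nat.count_strict_mono hw (hX.free_lt w hw.1)
  refine ⟨b.1 - 1, Nat.count (X.1.Branch G b.2) w, by omega, X.1.take G w, hws, hX.take w,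
    size_take_lt (hw.mem_useful hX.disj hp), ?_, fun β hβ => ?_⟩
  · exact size_take_add_three_mul_le hG hX.disj (by omega) (by omega) hmin'
      (hw.mem_useful hX.disj hp)
  · have hcount : ∀ m ≤ b.1 - 1, Nat.count (fun i => β (X.2 + i) = true) m
        = min m (Nat.count (X.1.Branch G b.2) w) := by
      intro m hm
      induction m with
      | zero => simp
      | succ m ih =>
        rw [Nat.count_succ, ih (by omega), hβ m (by omega)]
        simp only [decide_eq_true_eq]
        split_ifs <;> omega
    unfold searchRound
    rw [← hbdef, if_pos (by omega), hcount _ le_rfl, min_eq_right (by omega), Nat.nth_count hw]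

/-- A solvable instance of measure at most `m` is solved within `m` rounds with a suitable string
of bits, of which at most one third of the measure is consumed. -/
theorem exists_bits (hG : IsSubcubic G) (m : ℕ) (hX : X.1.Bounded n) (hsol : X.1.Solvable G)
    (hm : X.1.size G ≤ m) (β₀ : ℕ → Bool) :
    ∃ β : ℕ → Bool, (∀ i < X.2, β i = β₀ i) ∧ (∀ i, X.2 + X.1.size G / 3 ≤ i → β i = false) ∧
      ((searchRound G n β)^[m] X).1.req = ∅ := by
  induction m generalizing X β₀ with
  | zero =>
    refine ⟨fun i => if i < X.2 then β₀ i else false, ?_, ?_, ?_⟩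
    · intro i hi
      simp [hi]
    · intro i hi
      simp only [ite_eq_right_iff]
      omega
    · have : X.1.req.card = 0 := by
        unfold size at hm
        omega
      exact Finset.card_eq_zero.1 this
  | succ m ih =>
    obtain hreq | hreq := X.1.req.eq_empty_or_nonempty
    · refine ⟨fun i => if i < X.2 then β₀ i else false, ?_, ?_, search_req_eq_empty hreq⟩
      · intro i hi
        simp [hi]
      · intro i hi
        simp only [ite_eq_right_iff]
        omega
    obtain ⟨s, j, hjs, Y, hYs, hYb, hYlt, hYle, hround⟩ :=
      exists_searchRound_solvable hG hX hsol hreq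
    obtain ⟨β, hβ₁, hβ₂, hβ₃⟩ := ih (X := (Y, X.2 + s)) hYb hYs (by simp only; omega)
      fun i => if i < X.2 then β₀ i else decide (i - X.2 < j)
    refine ⟨β, fun i hi => ?_, fun i hi => hβ₂ i (by simp only; omega), ?_⟩
    · rw [hβ₁ i (by simp only; omega), if_pos hi]
    · rw [Function.iterate_succ_apply, hround β fun i hi => ?_]
      · exact hβ₃
      · rw [hβ₁ _ (by simp only; omega), if_neg (by omega), Nat.add_sub_cancel_left]

/-- The search over all strings of `n / 3` bits, written as numbers below `2 ^ (n / 3)`, is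
correct. -/
theorem solvable_iff_exists_search (hG : IsSubcubic G) {S : DomInst ℕ} (hS : S.Bounded n) :
    S.Solvable G ↔
      ∃ t < 2 ^ (n / 3), ((searchRound G n t.testBit)^[n] (S, 0)).1.req = ∅ := by
  classical
  refine ⟨fun h => ?_, fun ⟨t, _, ht⟩ => solvable_of_search ht⟩
  have hsize : S.size G ≤ n := by
    unfold size
    rw [← Finset.card_union_of_disjoint (Finset.disjoint_left.2 fun v hv hv' =>
      Finset.disjoint_left.1 hS.disj hv (mem_useful.1 hv').1)]
    refine (Finset.card_le_card (t := Finset.range n) fun v hv => ?_).trans_eq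
      (Finset.card_range n)
    obtain hv | hv := Finset.mem_union.1 hv
    · exact Finset.mem_range.2 (hS.req_lt v hv)
    · exact Finset.mem_range.2 (hS.free_lt v (mem_useful.1 hv).1)
  obtain ⟨β, -, hβ, hreq⟩ := exists_bits (X := (S, 0)) hG n hS h hsize fun _ => false
  refine ⟨Nat.ofBits fun i : Fin (n / 3) => β i, Nat.ofBits_lt_two_pow _, ?_⟩
  convert hreq
  ext i
  rw [Nat.testBit_ofBits]
  split_ifs with hi
  · rfl
  · exact (hβ i (by simp only; omega)).symm

end SearchRound

/-! ### Extension of vertex covers as a domination problem -/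

open Classical in
/-- The domination instance on `0, …, n - 1` that belongs to a vertex set `U`. -/
noncomputable def domInstOf {n : ℕ} (U : Set (Fin n)) : DomInst ℕ where
  req := (Finset.univ.filter (· ∈ U)).map Fin.valEmbedding
  free := (Finset.univ.filter (· ∉ U)).map Fin.valEmbedding

section DomInstOf

variable {n : ℕ} {G : SimpleGraph (Fin n)} {U : Set (Fin n)}

theorem mem_domInstOf_req {v : ℕ} : v ∈ (domInstOf U).req ↔ ∃ u : Fin n, u ∈ U ∧ u.val = v := by
  simp [domInstOf]

theorem mem_domInstOf_free {v : ℕ} :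
    v ∈ (domInstOf U).free ↔ ∃ u : Fin n, u ∉ U ∧ u.val = v := by
  simp [domInstOf]

theorem domInstOf_bounded : (domInstOf U).Bounded n where
  req_lt v hv := by obtain ⟨u, -, rfl⟩ := mem_domInstOf_req.1 hv; exact u.2
  free_lt v hv := by obtain ⟨u, -, rfl⟩ := mem_domInstOf_free.1 hv; exact u.2
  disj := Finset.disjoint_left.2 fun v hv hv' => by
    obtain ⟨u, hu, rfl⟩ := mem_domInstOf_req.1 hv
    obtain ⟨w, hw, h⟩ := mem_domInstOf_free.1 hv'
    exact hw (Fin.ext h ▸ hu)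

theorem map_adj_val {u v : Fin n} : (G.map Fin.valEmbedding).Adj u v ↔ G.Adj u v :=
  SimpleGraph.map_adj_apply (f := Fin.valEmbedding)

theorem isSubcubic_map (hG : IsSubcubic G) : IsSubcubic (G.map Fin.valEmbedding) := by
  intro v
  by_cases hv : v < n
  · have : (G.map Fin.valEmbedding).neighborSet v
        = Fin.valEmbedding '' G.neighborSet ⟨v, hv⟩ := by
      ext w
      simp only [SimpleGraph.mem_neighborSet, SimpleGraph.map_adj, Set.mem_image]
      constructor
      · rintro ⟨a, b, hab, rfl, rfl⟩
        exact ⟨b, hab, rfl⟩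
      · rintro ⟨b, hab, rfl⟩
        exact ⟨_, b, hab, rfl, rfl⟩
    rw [this, Fin.valEmbedding.injective.encard_image]
    exact hG _
  · have : (G.map Fin.valEmbedding).neighborSet v = ∅ := by
      ext w
      simp only [SimpleGraph.mem_neighborSet, SimpleGraph.map_adj, Set.mem_empty_iff_false,
        iff_false]
      rintro ⟨a, b, -, rfl, -⟩
      exact hv a.2
    rw [this, Set.encard_empty]
    exact zero_le

/-- The minimal vertex covers are the complements of the maximal independent sets. Hence `U`
extends to a minimal vertex cover iff some independent set outside `U` dominates `U`: such a set
extends to a maximal independent set, which still avoids `U`. -/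
theorem extVC_iff_solvable :
    ExtVC G U ↔ (domInstOf U).Solvable (G.map Fin.valEmbedding) := by
  constructor
  · rintro ⟨S, hS, hUS⟩
    refine ⟨Fin.val '' Sᶜ, ?_, ?_, ?_⟩
    · rintro _ ⟨x, hx, rfl⟩
      exact mem_domInstOf_free.2 ⟨x, fun h => hx (hUS h), rfl⟩
    · rintro _ ⟨x, hx, rfl⟩ _ ⟨y, hy, rfl⟩ hxy
      exact (hS.prop (map_adj_val.1 hxy)).elim hx hy
    · intro v hv
      obtain ⟨u, hu, rfl⟩ := mem_domInstOf_req.1 hv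
      by_contra! hcon
      -- otherwise `u` could be deleted from the cover
      have hcov : G.IsVertexCover (S \ {u}) := by
        intro a b hab
        by_cases ha : a = u
        · subst ha
          refine Or.inr ⟨?_, hab.ne'⟩
          by_contra hb
          exact hcon b ⟨b, hb, rfl⟩ (map_adj_val.2 hab.symm)
        by_cases hb : b = u
        · subst hb
          refine Or.inl ⟨?_, ha⟩
          by_contra ha'
          exact hcon a ⟨a, ha', rfl⟩ (map_adj_val.2 hab)
        · exact (hS.prop hab).imp (fun h => ⟨h, ha⟩) fun h => ⟨h, hb⟩
      exact (hS.le_of_le hcov Set.sdiff_subset (hUS hu)).2 rfl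
  · rintro ⟨I, hI, hind, hdom⟩
    have h₀ : G.IsIndepSet {x | x.val ∈ I} := fun x hx y hy _ hxy =>
      hind _ hx _ hy (map_adj_val.2 hxy)
    obtain ⟨J, hIJ, hJ⟩ := Set.Finite.exists_le_maximal (Set.toFinite {J | G.IsIndepSet J}) h₀
    refine ⟨Jᶜ, ⟨SimpleGraph.isVertexCover_compl.2 hJ.prop, fun C hC hCJ => ?_⟩, fun u hu huJ => ?_⟩
    · have := hJ.le_of_ge (SimpleGraph.isIndepSet_compl_iff_isVertexCover.2 hC)
        (Set.subset_compl_comm.1 hCJ)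
      exact Set.compl_subset_comm.1 this
    · obtain ⟨x, hx, hxu⟩ := hdom u (mem_domInstOf_req.2 ⟨u, hu, rfl⟩)
      obtain ⟨y, -, rfl⟩ := mem_domInstOf_free.1 (hI x hx)
      exact hJ.prop (hIJ hx) huJ (map_adj_val.1 hxu).ne (map_adj_val.1 hxu)

end DomInstOf

/-! ### The program for one round -/

namespace RAM

-- Variable `0` holds `n`. The variables `vV`, `vW`, `vU`, `vK`, `vI`, `vRound`, `vRest` and `vCount`
-- are counters; `vPivot` is the selected pivot, `vMin` the size of its branching set, `vPos` the
-- number of consumed bits, `vOnes` the number of ones among the bits of the current round, `vX` the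
-- vertex that is taken, and `vLen` the length of the bit strings.
local notation "vAns" => (1 : ℕ)
local notation "vV" => (2 : ℕ)
local notation "vW" => (3 : ℕ)
local notation "vU" => (4 : ℕ)
local notation "vFlag" => (5 : ℕ)
local notation "vCount" => (6 : ℕ)
local notation "vMin" => (7 : ℕ)
local notation "vPivot" => (8 : ℕ)
local notation "vPos" => (9 : ℕ)
local notation "vOnes" => (10 : ℕ)
local notation "vK" => (11 : ℕ)
local notation "vX" => (12 : ℕ)
local notation "vRound" => (13 : ℕ)
local notation "vI" => (14 : ℕ)
local notation "vLen" => (15 : ℕ)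
local notation "vRest" => (16 : ℕ)
local notation "aAdj" => (0 : ℕ)
local notation "aInput" => (1 : ℕ)
local notation "aState" => (2 : ℕ)
local notation "aBits" => (3 : ℕ)
local notation "aBranch" => (4 : ℕ)

/-- The test whether the entry `(i, j)` of array `a` is `c`, where `i` and `j` are variables. -/
def entryIs (a i j c : ℕ) : Test := .eq (.cell a (.var i) (.var j)) (.const c)

/-- The test whether the entry `i` of row `0` of array `a` is `c`, where `i` is a variable. -/
def rowIs (a i c : ℕ) : Test := .eq (.cell a (.const 0) (.var i)) (.const c)

@[simp]
theorem holds_entryIs {a i j c : ℕ} {σ : Store} :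
    (entryIs a i j c).Holds σ ↔ σ.arr a (σ.var i) (σ.var j) = c := Iff.rfl

@[simp]
theorem holds_rowIs {a i c : ℕ} {σ : Store} :
    (rowIs a i c).Holds σ ↔ σ.arr a 0 (σ.var i) = c := Iff.rfl

/-- `f := 1` if the test `b` holds for some `x < n`, and `f := 0` otherwise. -/
def existsBelow (f x : ℕ) (b : Test) : Prog :=
  .seq (.setVar f (.const 0)) (forUp x (.ite b (.setVar f (.const 1)) .skip))

/-- `c :=` the number of the `x < n` for which the test `b` holds. -/
def countBelow (c x : ℕ) (b : Test) : Prog :=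
  .seq (.setVar c (.const 0)) (forUp x (.ite b (.setVar c (.succ (.var c))) .skip))

theorem Run.existsBelow {n f x : ℕ} {b : Test} {σ : Store} (p : ℕ → Prop) (hn : σ.var 0 = n)
    (hx : (x == 0) = false) (hf : (0 == f) = false) (hfx : (x == f) = false)
    (hb : ∀ i < n, ∀ τ, τ.var x = i → (∀ y, y ≠ x → y ≠ f → τ.var y = σ.var y) →
      τ.arr = σ.arr → (b.Holds τ ↔ p i)) :
    Run n (existsBelow f x b) (fun τ => τ.var f = 1 ↔ ∃ i < n, p i) σ := by
  have hx' : x ≠ 0 := by simpa using hx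
  have hf' : 0 ≠ f := by simpa using hf
  have hfx' : x ≠ f := by simpa using hfx
  refine .seq (.setVar ?_)
  refine .forUp (fun i τ => τ.var f = 1 ↔ ∃ k < i, p k) ?_ hx ?_ ?_ ?_ ?_
  · simp [Store.setVar, hf', hn]
  · simp [Prog.writesVar, hf]
  · simp [Prog.writesVar, hfx]
  · simp [Store.setVar, Expr.eval, hfx'.symm]
  · intro i hi τ hτ hfr hinv
    have hbi := hb i hi τ hτ (fun y hy hy' => by
      rw [hfr.var y (by simp [RAM.forUp, Prog.writesVar, hy, hy'])]
      simp [Store.setVar, hy']) (by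
      funext a
      rw [hfr.arr a (by simp [RAM.forUp, Prog.writesArr])]
      rfl)
    have hsucc : (∃ k < i + 1, p k) ↔ (∃ k < i, p k) ∨ p i := by
      simp only [Nat.lt_succ_iff_lt_or_eq, or_and_right, exists_or, exists_eq_left]
    refine .ite (fun h => .setVar ?_) fun h => .skip ?_
    · rw [hsucc]
      simp [Store.setVar, Expr.eval, hfx'.symm, hbi.1 h]
    · rw [hsucc]
      rw [hbi] at h
      simpa [Store.setVar, hfx'.symm, h] using hinv

theorem Run.countBelow {n c x : ℕ} {b : Test} {σ : Store} (p : ℕ → Prop) [DecidablePred p]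
    (hn : σ.var 0 = n)
    (hx : (x == 0) = false) (hc : (0 == c) = false) (hcx : (x == c) = false)
    (hb : ∀ i < n, ∀ τ, τ.var x = i → (∀ y, y ≠ x → y ≠ c → τ.var y = σ.var y) →
      τ.arr = σ.arr → (b.Holds τ ↔ p i)) :
    Run n (countBelow c x b) (fun τ => τ.var c = Nat.count p n) σ := by
  have hx' : x ≠ 0 := by simpa using hx
  have hc' : 0 ≠ c := by simpa using hc
  have hcx' : x ≠ c := by simpa using hcx
  refine .seq (.setVar ?_)
  refine .forUp (fun i τ => τ.var c = Nat.count p i) ?_ hx ?_ ?_ ?_ ?_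
  · simp [Store.setVar, hc', hn]
  · simp [Prog.writesVar, hc]
  · simp [Prog.writesVar, hcx]
  · simp [Store.setVar, Expr.eval, hcx'.symm]
  · intro i hi τ hτ hfr hinv
    have hbi := hb i hi τ hτ (fun y hy hy' => by
      rw [hfr.var y (by simp [RAM.forUp, Prog.writesVar, hy, hy'])]
      simp [Store.setVar, hy']) (by
      funext a
      rw [hfr.arr a (by simp [RAM.forUp, Prog.writesArr])]
      rfl)
    refine .ite (fun h => .setVar ?_) fun h => .skip ?_
    · rw [Nat.count_succ, if_pos (hbi.1 h)]
      simp [Store.setVar, Expr.eval, hcx'.symm, hinv]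
    · rw [Nat.count_succ, if_neg (mt hbi.2 h)]
      simpa [Store.setVar, hcx'.symm] using hinv

/-- The store `σ` holds the graph `G` and the instance `S`: in the state array, required vertices
have the entry `1` and free vertices the entry `2`. -/
structure Encodes (n : ℕ) (G : SimpleGraph ℕ) (S : DomInst ℕ) (σ : Store) : Prop where
  var_zero : σ.var 0 = n
  adj : ∀ u v, σ.arr aAdj u v = 1 ↔ G.Adj u v
  req : ∀ v, σ.arr aState 0 v = 1 ↔ v ∈ S.req
  free : ∀ v, σ.arr aState 0 v = 2 ↔ v ∈ S.free

theorem Encodes.congr {n : ℕ} {G : SimpleGraph ℕ} {S : DomInst ℕ} {σ τ : Store}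
    (h : Encodes n G S σ) (h0 : τ.var 0 = σ.var 0) (hadj : τ.arr aAdj = σ.arr aAdj)
    (hst : τ.arr aState = σ.arr aState) : Encodes n G S τ where
  var_zero := h0.trans h.var_zero
  adj := by rw [hadj]; exact h.adj
  req := by rw [hst]; exact h.req
  free := by rw [hst]; exact h.free

theorem Encodes.frame {n : ℕ} {G : SimpleGraph ℕ} {S : DomInst ℕ} {σ τ : Store} {P : Prog}
    (h : Encodes n G S σ) (hf : Frame P σ τ) (h0 : P.writesVar 0 = false := by rfl)
    (hadj : P.writesArr aAdj = false := by rfl)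
    (hst : P.writesArr aState = false := by rfl) : Encodes n G S τ :=
  h.congr (hf.var 0 h0) (hf.arr _ hadj) (hf.arr _ hst)

/-- Fills the branch array with the characteristic functions of the branching sets. -/
def fillBranch : Prog :=
  forUp vV (forUp vW (.seq
    (existsBelow vFlag vU
      (.and (rowIs aState vU 1) (.and (entryIs aAdj vW vU 1) (.not (entryIs aAdj vV vU 1)))))
    (.ite (.and (rowIs aState vW 2)
        (.or (.and (rowIs aState vV 1) (entryIs aAdj vV vW 1))
          (.and (rowIs aState vV 2)
            (.or (.eq (.var vW) (.var vV))
              (.and (entryIs aAdj vV vW 1) (.eq (.var vFlag) (.const 1)))))))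
      (.setCell aBranch (.var vV) (.var vW) (.const 1))
      (.setCell aBranch (.var vV) (.var vW) (.const 0)))))

theorem Run.fillBranch {n : ℕ} {G : SimpleGraph ℕ} {S : DomInst ℕ} {σ : Store}
    (hS : S.Bounded n) (h : Encodes n G S σ) :
    Run n fillBranch
      (fun τ => ∀ v < n, ∀ w < n, (τ.arr aBranch v w = 1 ↔ S.Branch G v w)) σ := by
  refine .forUp (fun i τ => ∀ v < i, ∀ w < n, (τ.arr aBranch v w = 1 ↔ S.Branch G v w))
    h.var_zero rfl rfl rfl (fun v hv => absurd hv (Nat.not_lt_zero v)) ?_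
  intro v hv τ hτv hτ hinv
  have hE := h.frame hτ
  refine (Run.forUp (fun i τ => (∀ v' < v, ∀ w < n, (τ.arr aBranch v' w = 1 ↔ S.Branch G v' w)) ∧
    ∀ w < i, (τ.arr aBranch v w = 1 ↔ S.Branch G v w))
    hE.var_zero rfl rfl rfl ⟨hinv, fun w hw => absurd hw (Nat.not_lt_zero w)⟩ ?_).mono ?_
  · rintro w hw ρ hρw hρ ⟨hinv₁, hinv₂⟩
    have hE' := hE.frame hρ
    have hρv : ρ.var vV = v := (hρ.var vV rfl).trans hτv
    refine .seq ((Run.existsBelow (fun u => u ∈ S.req ∧ G.Adj w u ∧ ¬ G.Adj v u)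
      hE'.var_zero rfl rfl rfl ?_).mono ?_)
    · intro u hu κ hκu hκ hκa
      simp [Test.Holds, hκu, hκa, hκ vW, hκ vV, hρw, hρv, hE'.adj, hE'.req]
    · intro κ hκ hκf
      have hE'' := hE'.frame hκf
      have hκv : κ.var vV = v := (hκf.var vV rfl).trans hρv
      have hκw : κ.var vW = w := (hκf.var vW rfl).trans hρw
      have hκb : κ.arr aBranch = ρ.arr aBranch := hκf.arr aBranch rfl
      have hflag : κ.var vFlag = 1 ↔ ∃ u ∈ S.req, G.Adj w u ∧ ¬ G.Adj v u := by
        rw [hκ]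
        exact ⟨fun ⟨u, _, hu⟩ => ⟨u, hu⟩, fun ⟨u, hu⟩ => ⟨u, hS.req_lt u hu.1, hu⟩⟩
      have hwrite : ∀ c, (c = 1 ↔ S.Branch G v w) →
          (∀ v' < v, ∀ w' < n,
            ((κ.setCell aBranch v w c).arr aBranch v' w' = 1 ↔ S.Branch G v' w')) ∧
          ∀ w' < w + 1,
            ((κ.setCell aBranch v w c).arr aBranch v w' = 1 ↔ S.Branch G v w') := by
        refine fun c hc => ⟨fun v' hv' w' hw' => ?_, fun w' hw' => ?_⟩
        · simpa [Store.setCell, hv'.ne, hκb] using hinv₁ v' hv' w' hw'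
        · obtain hw' | rfl := Nat.lt_succ_iff_lt_or_eq.1 hw'
          · simpa [Store.setCell, hw'.ne, hκb] using hinv₂ w' hw'
          · simpa [Store.setCell] using hc
      refine .ite (fun hb => .setCell ?_) fun hb => .setCell ?_
      · simp only [Test.Holds, Test.holds_or, holds_rowIs, holds_entryIs, Expr.eval, hκv, hκw,
          hE''.adj, hE''.req, hE''.free, hflag] at hb
        simp only [Expr.eval, hκv, hκw]
        exact hwrite 1 (iff_of_true rfl hb)
      · simp only [Test.Holds, Test.holds_or, holds_rowIs, holds_entryIs, Expr.eval, hκv, hκw,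
          hE''.adj, hE''.req, hE''.free, hflag] at hb
        simp only [Expr.eval, hκv, hκw]
        exact hwrite 0 (iff_of_false zero_ne_one hb)
  · rintro ρ ⟨h₁, h₂⟩ - v' hv' w hw
    obtain hv' | rfl := Nat.lt_succ_iff_lt_or_eq.1 hv'
    · exact h₁ v' hv' w hw
    · exact h₂ w hw

/-- Selects a pivot with a branching set of the least size. -/
def findPivot : Prog :=
  .seq (.setVar vMin (.const 4)) (.seq (.setVar vPivot (.const 0))
    (forUp vV (.seq
      (existsBelow vFlag vU (.and (rowIs aState vU 1) (entryIs aAdj vV vU 1)))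
      (.seq (countBelow vCount vW (entryIs aBranch vV vW 1))
        (.ite (.and (.or (rowIs aState vV 1)
              (.and (rowIs aState vV 2) (.eq (.var vFlag) (.const 1))))
            (.lt (.var vCount) (.var vMin)))
          (.seq (.setVar vMin (.var vCount)) (.setVar vPivot (.var vV))) .skip)))))

theorem Run.findPivot {n : ℕ} {G : SimpleGraph ℕ} {S : DomInst ℕ} {σ : Store}
    (hS : S.Bounded n) (h : Encodes n G S σ)
    (hbr : ∀ v < n, ∀ w < n, (σ.arr aBranch v w = 1 ↔ S.Branch G v w)) :
    Run n findPivot (fun τ => (τ.var vMin, τ.var vPivot) =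
      argminBelow (S.Pivot G) (S.branchCount G n) n) σ := by
  classical
  refine .seq (.setVar (.seq (.setVar ?_)))
  refine .forUp (fun i τ => (τ.var vMin, τ.var vPivot) =
      argminBelow (S.Pivot G) (S.branchCount G n) i) h.var_zero rfl rfl rfl rfl ?_
  intro v hv τ hτv hτ hinv
  have hE : Encodes n G S τ :=
    h.congr (hτ.var 0 rfl) (hτ.arr aAdj rfl) (hτ.arr aState rfl)
  have hτb : τ.arr aBranch = σ.arr aBranch := hτ.arr aBranch rfl
  refine .seq ((Run.existsBelow (fun u => u ∈ S.req ∧ G.Adj v u)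
      hE.var_zero rfl rfl rfl ?_).mono ?_)
  · intro u hu κ hκu hκ hκa
    simp [Test.Holds, hκu, hκa, hκ vV, hτv, hE.adj, hE.req]
  intro ρ hflag hρ
  have hE' := hE.frame hρ
  have hρv : ρ.var vV = v := (hρ.var vV rfl).trans hτv
  have hρb : ρ.arr aBranch = σ.arr aBranch := (hρ.arr aBranch rfl).trans hτb
  refine .seq ((Run.countBelow (S.Branch G v) hE'.var_zero rfl rfl rfl ?_).mono ?_)
  · intro w hw κ hκw hκ hκa
    simp [hκw, hκa, hκ vV, hρv, hρb, hbr v hv w hw]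
  intro κ hcount hκ
  have hE'' := hE'.frame hκ
  have hκv : κ.var vV = v := (hκ.var vV rfl).trans hρv
  have hκmin : (κ.var vMin, κ.var vPivot) = argminBelow (S.Pivot G) (S.branchCount G n) v := by
    rw [hκ.var vMin rfl, hκ.var vPivot rfl, hρ.var vMin rfl, hρ.var vPivot rfl, hinv]
  have hκc : κ.var vCount = S.branchCount G n v := hcount
  have hκf : κ.var vFlag = 1 ↔ ∃ u ∈ S.req, G.Adj v u := by
    rw [hκ.var vFlag rfl, hflag]
    exact ⟨fun ⟨u, _, hu⟩ => ⟨u, hu⟩, fun ⟨u, hu⟩ => ⟨u, hS.req_lt u hu.1, hu⟩⟩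
  have htest : (S.Pivot G v ∧ S.branchCount G n v <
      (argminBelow (S.Pivot G) (S.branchCount G n) v).1) ↔
      ((S.Pivot G v) ∧ κ.var vCount < κ.var vMin) := by
    rw [hκc, ← hκmin]
  refine .ite (fun hb => .seq (.setVar (.setVar ?_))) fun hb => .skip ?_
  · simp only [Test.Holds, Test.holds_or, holds_rowIs, Expr.eval, hκv,
      hE''.req, hE''.free, hκf] at hb
    rw [argminBelow, if_pos (htest.2 hb)]
    simp [Store.setVar, Expr.eval, hκv, hκc]
  · simp only [Test.Holds, Test.holds_or, holds_rowIs, Expr.eval, hκv,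
      hE''.req, hE''.free, hκf] at hb
    rw [argminBelow, if_neg (mt htest.1 hb)]
    simpa [Store.setVar] using hκmin

/-- Consumes one bit less than the size of the selected branching set, and counts the ones. -/
def readBits : Prog :=
  .seq (.setVar vOnes (.const 0)) (.seq (.setVar vK (.const 1))
    (.loop (.lt (.var vK) (.var vMin))
      (.seq (.ite (rowIs aBits vPos 1) (.setVar vOnes (.succ (.var vOnes))) .skip)
        (.seq (.setVar vPos (.succ (.var vPos))) (.setVar vK (.succ (.var vK)))))))

theorem Run.readBits {n pos s : ℕ} {β : ℕ → Bool} {σ : Store} (hs : 0 < s) (hs4 : s < 4)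
    (hpos : σ.var vPos = pos) (hmin : σ.var vMin = s)
    (hβ : ∀ i, σ.arr aBits 0 i = 1 ↔ β i = true) :
    Run n readBits (fun τ => τ.var vPos = pos + (s - 1) ∧
      τ.var vOnes = Nat.count (fun i => β (pos + i) = true) (s - 1)) σ := by
  refine .seq (.setVar (.seq (.setVar ?_)))
  refine (Run.loop (m := s - 1) (by omega) (fun i τ => τ.arr aBits = σ.arr aBits ∧
    τ.var vMin = s ∧ τ.var vK = i + 1 ∧ τ.var vPos = pos + i ∧
    τ.var vOnes = Nat.count (fun i => β (pos + i) = true) i) ?_ ?_ ?_).mono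
    fun τ hτ _ => hτ.2.2.2
  · simp [Store.setVar, Expr.eval, hpos, hmin]
  · rintro i hi τ ⟨h1, h2, h3, h4, h5⟩
    refine ⟨by simp only [Test.Holds, Expr.eval, h2, h3]; omega, .seq (.ite ?_ ?_)⟩
    · intro hb
      have hb' : β (pos + i) = true := by
        rwa [holds_rowIs, h1, h4, hβ] at hb
      refine .setVar (.seq (.setVar (.setVar ?_)))
      simp [Store.setVar, Expr.eval, h1, h2, h3, h4, h5, Nat.count_succ, hb', Nat.add_assoc]
    · intro hb
      have hb' : ¬ β (pos + i) = true := by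
        rwa [holds_rowIs, h1, h4, hβ] at hb
      refine .skip (.seq (.setVar (.setVar ?_)))
      simp [Store.setVar, Expr.eval, h1, h2, h3, h4, h5, Nat.count_succ, hb', Nat.add_assoc]
  · rintro τ ⟨-, h2, h3, -⟩
    simp only [Test.Holds, Expr.eval, h2, h3]
    omega

/-- Finds the element of the branching set of the selected pivot that has as many predecessors in
that set as ones have been read. -/
def findVertex : Prog :=
  .seq (.setVar vCount (.const 0)) (.seq (.setVar vX (.const 0))
    (forUp vW (.ite (entryIs aBranch vPivot vW 1)
      (.seq (.ite (.eq (.var vCount) (.var vOnes)) (.setVar vX (.var vW)) .skip)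
        (.setVar vCount (.succ (.var vCount)))) .skip)))

theorem Run.findVertex {n v j : ℕ} {p : ℕ → Prop} [DecidablePred p] {σ : Store}
    (hn : σ.var 0 = n) (hv : σ.var vPivot = v) (hj : σ.var vOnes = j)
    (hp : ∀ w < n, (σ.arr aBranch v w = 1 ↔ p w)) (hjn : j < Nat.count p n) :
    Run n findVertex (fun τ => τ.var vX = Nat.nth p j) σ := by
  refine .seq (.setVar (.seq (.setVar ?_)))
  refine Run.mono (Run.forUp (fun i τ => τ.var vCount = Nat.count p i ∧
    (j < Nat.count p i → τ.var vX = Nat.nth p j)) hn rfl rfl rfl ?_ ?_)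
    fun τ hτ _ => hτ.2 hjn
  · simp [Store.setVar, Expr.eval]
  · rintro w hw τ hτw hτ ⟨h1, h2⟩
    have hτv : τ.var vPivot = v := (hτ.var vPivot rfl).trans hv
    have hτj : τ.var vOnes = j := (hτ.var vOnes rfl).trans hj
    have hτb : τ.arr aBranch = σ.arr aBranch := hτ.arr aBranch rfl
    refine .ite (fun hb => .seq (.ite (fun hc => .setVar (.setVar ?_))
      fun hc => .skip (.setVar ?_))) fun hb => .skip ?_
    · rw [holds_entryIs, hτb, hτv, hτw, hp w hw] at hb
      simp only [Test.Holds, Expr.eval, h1, hτj] at hc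
      subst hc
      simp [Store.setVar, Expr.eval, Nat.count_succ, hb, h1, hτw, Nat.nth_count hb]
    · rw [holds_entryIs, hτb, hτv, hτw, hp w hw] at hb
      simp only [Test.Holds, Expr.eval, h1, hτj] at hc
      simp only [Store.setVar, Expr.eval, Nat.count_succ, hb, h1]
      simp only [Nat.reduceEqDiff, if_true, if_false]
      exact ⟨trivial, fun hlt => h2 (by omega)⟩
    · rw [holds_entryIs, hτb, hτv, hτw, hp w hw] at hb
      simpa [Store.setVar, Nat.count_succ, hb] using And.intro h1 h2

/-- Removes the selected vertex and all its neighbors from the instance. -/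
def takeVertex : Prog :=
  .seq (.setCell aState (.const 0) (.var vX) (.const 0))
    (forUp vW (.ite (entryIs aAdj vX vW 1)
      (.setCell aState (.const 0) (.var vW) (.const 0)) .skip))

theorem Run.takeVertex {n x : ℕ} {G : SimpleGraph ℕ} {S : DomInst ℕ} {σ : Store}
    (hS : S.Bounded n) (h : Encodes n G S σ) (hx : σ.var vX = x) (hxS : x ∈ S.free) :
    Run n takeVertex (Encodes n G (S.take G x)) σ := by
  classical
  refine .seq (.setCell ?_)
  simp only [Expr.eval, hx]
  refine Run.mono (Run.forUp (fun i τ => ∀ v, τ.arr aState 0 v =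
    if v = x ∨ v < i ∧ G.Adj x v then 0 else σ.arr aState 0 v) h.var_zero rfl rfl rfl ?_ ?_) ?_
  · intro v
    by_cases hv : v = x <;> simp [Store.setVar, Store.setCell, hv]
  · intro w hw τ hτw hτ hinv
    have hτx : τ.var vX = x := (hτ.var vX rfl).trans hx
    have hτa : τ.arr aAdj = σ.arr aAdj := hτ.arr aAdj rfl
    refine .ite (fun hb => .setCell ?_) fun hb => .skip ?_
    · rw [holds_entryIs, hτa, hτx, hτw, h.adj] at hb
      intro v
      simp only [Store.setVar, Store.setCell, Expr.eval, hτw, hinv, true_and]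
      by_cases hv : v = w
      · simp [hv, hb]
      · have : v < w + 1 ↔ v < w := by omega
        simp [hv, this]
    · rw [holds_entryIs, hτa, hτx, hτw, h.adj] at hb
      intro v
      simp only [Store.setVar, hinv]
      by_cases hv : v = w
      · simp [hv, hb]
      · have : v < w + 1 ↔ v < w := by omega
        simp [this]
  · intro τ hτ hfr
    have hxr : x ∉ S.req := fun hxr => Finset.disjoint_left.1 hS.disj hxr hxS
    refine ⟨(hfr.var 0 rfl).trans h.var_zero, fun u v => ?_, fun v => ?_, fun v => ?_⟩
    · rw [hfr.arr aAdj rfl]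
      exact h.adj u v
    · rw [hτ, DomInst.mem_take_req, ← h.req]
      have h1 : σ.arr aState 0 v = 1 → v < n := fun hv => hS.req_lt v ((h.req v).1 hv)
      have h2 : σ.arr aState 0 x ≠ 1 := fun hx => hxr ((h.req x).1 hx)
      grind
    · rw [hτ, DomInst.mem_take_free, ← h.free]
      have h1 : σ.arr aState 0 v = 2 → v < n := fun hv => hS.free_lt v ((h.free v).1 hv)
      grind

/-- One round of the search. -/
def roundProg : Prog :=
  .seq fillBranch (.seq findPivot
    (.ite (.and (.lt (.const 0) (.var vMin)) (.lt (.var vMin) (.const 4)))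
      (.seq readBits (.seq findVertex takeVertex)) .skip))

/-- The store holds the graph, the bit string `β` and the state `X` of the search. -/
structure Represents (n : ℕ) (G : SimpleGraph ℕ) (β : ℕ → Bool) (X : DomInst ℕ × ℕ)
    (σ : Store) : Prop where
  encodes : Encodes n G X.1 σ
  pos : σ.var vPos = X.2
  bits : ∀ i, σ.arr aBits 0 i = 1 ↔ β i = true

theorem Run.roundProg {n : ℕ} {G : SimpleGraph ℕ} {β : ℕ → Bool} {X : DomInst ℕ × ℕ} {σ : Store}
    (hX : X.1.Bounded n) (h : Represents n G β X σ) :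
    Run n roundProg (Represents n G β (searchRound G n β X)) σ := by
  classical
  refine .seq ((Run.fillBranch hX h.encodes).mono fun σ₁ hbr hσ₁ => ?_)
  have hE₁ := h.encodes.frame hσ₁
  refine .seq ((Run.findPivot hX hE₁ hbr).mono fun σ₂ hpiv hσ₂ => ?_)
  have hE₂ := hE₁.frame hσ₂
  have hpos₂ : σ₂.var vPos = X.2 := by rw [hσ₂.var vPos rfl, hσ₁.var vPos rfl, h.pos]
  have hbits₂ : ∀ i, σ₂.arr aBits 0 i = 1 ↔ β i = true := by
    rw [hσ₂.arr aBits rfl, hσ₁.arr aBits rfl]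
    exact h.bits
  have hspec := (argminBelow_spec (X.1.Pivot G) (X.1.branchCount G n) n).1
  unfold searchRound
  rw [← hpiv] at hspec ⊢
  simp only at hspec ⊢
  refine .ite (fun hb => ?_) fun hb => .skip ?_
  · obtain ⟨hb0, hb4⟩ : 0 < σ₂.var vMin ∧ σ₂.var vMin < 4 := hb
    obtain ⟨hp, hc⟩ := hspec hb4
    have hvn : σ₂.var vPivot < n := hp.elim (hX.req_lt _) fun h => hX.free_lt _ h.1
    rw [if_pos ⟨hb0, hb4⟩]
    refine .seq ((Run.readBits hb0 hb4 hpos₂ rfl hbits₂).mono fun σ₃ hread hσ₃ => ?_)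
    have hE₃ := hE₂.frame hσ₃
    have hj : Nat.count (fun i => β (X.2 + i) = true) (σ₂.var vMin - 1) <
        Nat.count (X.1.Branch G (σ₂.var vPivot)) n := by
      rw [DomInst.branchCount] at hc
      rw [hc]
      exact (Nat.count_le _).trans_lt (by omega)
    refine .seq ((Run.findVertex hE₃.var_zero (hσ₃.var vPivot rfl) hread.2 (fun w hw => ?_)
      hj).mono fun σ₄ hx hσ₄ => ?_)
    · rw [hσ₃.arr aBranch rfl, hσ₂.arr aBranch rfl, hbr _ hvn w hw]
    have hE₄ := hE₃.frame hσ₄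
    refine (Run.takeVertex hX hE₄ hx (nth_mem_of_lt_count hj).1).mono fun σ₅ hE₅ hσ₅ => ⟨hE₅, ?_, ?_⟩
    · rw [hσ₅.var vPos rfl, hσ₄.var vPos rfl, hread.1]
    · rw [hσ₅.arr aBits rfl, hσ₄.arr aBits rfl, hσ₃.arr aBits rfl]
      exact hbits₂
  · rw [if_neg (by exact hb)]
    exact ⟨hE₂, hpos₂, hbits₂⟩

/-! ### The whole program -/

/-- Resets the instance to the one given by the input. -/
def initState : Prog :=
  .seq (.setVar vPos (.const 0))
    (forUp vV (.ite (rowIs aInput vV 1) (.setCell aState (.const 0) (.var vV) (.const 1))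
      (.setCell aState (.const 0) (.var vV) (.const 2))))

/-- Runs the search with the current bit string, and sets the answer to `1` if it succeeds. -/
def trial : Prog :=
  .seq initState (.seq (forUp vRound roundProg)
    (.seq (existsBelow vFlag vU (rowIs aState vU 1))
      (.ite (.eq (.var vFlag) (.const 1)) .skip (.setVar vAns (.const 1)))))

/-- Adds one to the binary number in the bit array. -/
def increment : Prog :=
  .seq (.setVar vI (.const 0))
    (.seq (.loop (rowIs aBits vI 1)
        (.seq (.setCell aBits (.const 0) (.var vI) (.const 0)) (.setVar vI (.succ (.var vI)))))
      (.setCell aBits (.const 0) (.var vI) (.const 1)))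

/-- Computes the length `n / 3` of the bit strings. -/
def bitLength : Prog :=
  .seq (.setVar vRest (.var 0))
    (.loop (.lt (.const 2) (.var vRest))
      (.seq (.setVar vRest (.pred (.pred (.pred (.var vRest)))))
        (.setVar vLen (.succ (.var vLen)))))

/-- The program: try all strings of `n / 3` bits, until the counter overflows. -/
def extVCProg : Prog :=
  .seq bitLength
    (.seq (.loop (rowIs aBits vLen 0) (.seq trial increment)) (.setVar 0 (.var vAns)))

section Correctness

variable {n : ℕ} {G : SimpleGraph (Fin n)} {U : Set (Fin n)} {σ : Store}

/-- What the runs of the search leave intact: the input, and the entries of the state array that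
do not belong to vertices. -/
structure Ready (G : SimpleGraph (Fin n)) (U : Set (Fin n)) (σ : Store) : Prop where
  var_zero : σ.var 0 = n
  adj : σ.arr aAdj = (input G U).arr aAdj
  inp : σ.arr aInput = (input G U).arr aInput
  state : ∀ v, n ≤ v → σ.arr aState 0 v ≠ 1 ∧ σ.arr aState 0 v ≠ 2

theorem input_adj {u v : ℕ} :
    (input G U).arr aAdj u v = 1 ↔ (G.map Fin.valEmbedding).Adj u v := by
  have : (G.map Fin.valEmbedding).Adj u v ↔ ∃ a b : Fin n, a.val = u ∧ b.val = v ∧ G.Adj a b := by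
    rw [SimpleGraph.map_adj]
    exact ⟨fun ⟨a, b, h, ha, hb⟩ => ⟨a, b, ha, hb, h⟩, fun ⟨a, b, ha, hb, h⟩ => ⟨a, b, h, ha, hb⟩⟩
  rw [this]
  simp [input]

theorem input_set {v : ℕ} :
    (input G U).arr aInput 0 v = 1 ↔ v ∈ (domInstOf U).req := by
  have : v ∈ (domInstOf U).req ↔ ∃ u : Fin n, u.val = v ∧ u ∈ U := by
    rw [mem_domInstOf_req]
    exact exists_congr fun u => and_comm
  rw [this]
  simp [input]

theorem Run.initState (h : Ready G U σ) :
    Run n initState (fun τ => Encodes n (G.map Fin.valEmbedding) (domInstOf U) τ ∧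
      τ.var vPos = 0) σ := by
  refine .seq (.setVar (Run.mono (Run.forUp (fun i τ =>
    (∀ v < i, τ.arr aState 0 v = if σ.arr aInput 0 v = 1 then 1 else 2) ∧
    ∀ v, n ≤ v → τ.arr aState 0 v ≠ 1 ∧ τ.arr aState 0 v ≠ 2) h.var_zero rfl rfl rfl ?_ ?_) ?_))
  · exact ⟨fun v hv => absurd hv (Nat.not_lt_zero v), h.state⟩
  · rintro v hv τ hτv hτ ⟨h₁, h₂⟩
    have hτi : τ.arr aInput = σ.arr aInput := hτ.arr aInput rfl
    have hwrite : ∀ c, c = (if σ.arr aInput 0 v = 1 then 1 else 2) →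
        (∀ w < v + 1, (τ.setCell aState 0 v c).arr aState 0 w =
          if σ.arr aInput 0 w = 1 then 1 else 2) ∧
        ∀ w, n ≤ w → (τ.setCell aState 0 v c).arr aState 0 w ≠ 1 ∧
          (τ.setCell aState 0 v c).arr aState 0 w ≠ 2 := by
      refine fun c hc => ⟨fun w hw => ?_, fun w hw => ?_⟩
      · obtain hw | rfl := Nat.lt_succ_iff_lt_or_eq.1 hw
        · simpa [Store.setCell, hw.ne] using h₁ w hw
        · simpa [Store.setCell] using hc
      · have : w ≠ v := by omega
        simpa [Store.setCell, this] using h₂ w hw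
    refine .ite (fun hb => .setCell ?_) fun hb => .setCell ?_
    · rw [holds_rowIs, hτi, hτv] at hb
      simp only [Expr.eval, hτv]
      exact hwrite 1 (if_pos hb).symm
    · rw [holds_rowIs, hτi, hτv] at hb
      simp only [Expr.eval, hτv]
      exact hwrite 2 (if_neg hb).symm
  · rintro τ ⟨h₁, h₂⟩ hτ
    have hin : ∀ v, σ.arr aInput 0 v = 1 ↔ v ∈ (domInstOf U).req := fun v => by
      rw [h.inp, input_set]
    refine ⟨⟨(hτ.var 0 rfl).trans h.var_zero, fun u v => ?_, fun v => ?_, fun v => ?_⟩,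
      hτ.var vPos rfl⟩
    · rw [hτ.arr aAdj rfl, ← input_adj (U := U), ← h.adj]
      rfl
    · by_cases hv : v < n
      · rw [h₁ v hv, ← hin]
        split_ifs with hU <;> simp [hU]
      · exact iff_of_false (h₂ v (by omega)).1 fun h => hv (domInstOf_bounded.req_lt v h)
    · by_cases hv : v < n
      · have : v ∈ (domInstOf U).free ↔ v ∉ (domInstOf U).req := by
          constructor
          · exact fun hf hr => Finset.disjoint_left.1 domInstOf_bounded.disj hr hf
          · intro hr
            refine mem_domInstOf_free.2 ⟨⟨v, hv⟩, fun hU => hr ?_, rfl⟩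
            exact mem_domInstOf_req.2 ⟨⟨v, hv⟩, hU, rfl⟩
        rw [h₁ v hv, this, ← hin]
        split_ifs with hU <;> simp [hU]
      · exact iff_of_false (h₂ v (by omega)).2 fun h => hv (domInstOf_bounded.free_lt v h)

/-- The search for `(G, U)` with the bit string `β` is successful. -/
def Succeeds (G : SimpleGraph (Fin n)) (U : Set (Fin n)) (β : ℕ → Bool) : Prop :=
  ((searchRound (G.map Fin.valEmbedding) n β)^[n] (domInstOf U, 0)).1.req = ∅

open Classical in
theorem Run.trial {β : ℕ → Bool} (h : Ready G U σ)
    (hβ : ∀ i, σ.arr aBits 0 i = 1 ↔ β i = true) :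
    Run n trial (fun τ => Ready G U τ ∧
      τ.var vAns = if Succeeds G U β then 1 else σ.var vAns) σ := by
  refine .seq ((Run.initState h).mono fun σ₁ ⟨hE₁, hpos₁⟩ hσ₁ => ?_)
  refine .seq (Run.mono (Run.forUp (fun i τ =>
    ((searchRound (G.map Fin.valEmbedding) n β)^[i] (domInstOf U, 0)).1.Bounded n ∧
    Represents n (G.map Fin.valEmbedding) β
      ((searchRound (G.map Fin.valEmbedding) n β)^[i] (domInstOf U, 0)) τ)
    hE₁.var_zero rfl rfl rfl ?_ ?_) ?_)
  · refine ⟨domInstOf_bounded, hE₁.congr rfl rfl rfl, hpos₁, ?_⟩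
    intro i
    rw [← hβ, ← hσ₁.arr aBits rfl]
    rfl
  · rintro i - τ - - ⟨hb, hr⟩
    rw [Function.iterate_succ_apply']
    exact (Run.roundProg hb hr).mono fun ρ hρ _ =>
      ⟨hb.searchRound, hρ.encodes.congr rfl rfl rfl, hρ.pos, hρ.bits⟩
  rintro σ₂ ⟨hb, hr⟩ hσ₂
  refine .seq ((Run.existsBelow (fun u => u ∈
    ((searchRound (G.map Fin.valEmbedding) n β)^[n] (domInstOf U, 0)).1.req)
    hr.encodes.var_zero rfl rfl rfl ?_).mono ?_)
  · intro u _ τ hτu _ hτa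
    rw [holds_rowIs, hτa, hτu, hr.encodes.req]
  intro σ₃ hflag hσ₃
  have hE₃ := hr.encodes.frame hσ₃
  have hready : Ready G U σ₃ := by
    refine ⟨hE₃.var_zero, ?_, ?_, fun v hv => ⟨fun h1 => ?_, fun h2 => ?_⟩⟩
    · rw [hσ₃.arr aAdj rfl, hσ₂.arr aAdj rfl, hσ₁.arr aAdj rfl, h.adj]
    · rw [hσ₃.arr aInput rfl, hσ₂.arr aInput rfl, hσ₁.arr aInput rfl, h.inp]
    · exact absurd (hb.req_lt v ((hE₃.req v).1 h1)) (by omega)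
    · exact absurd (hb.free_lt v ((hE₃.free v).1 h2)) (by omega)
  have hsucc : σ₃.var vFlag = 1 ↔ ¬ Succeeds G U β := by
    rw [hflag, Succeeds, ← ne_eq, ← Finset.nonempty_iff_ne_empty]
    exact ⟨fun ⟨u, _, hu⟩ => ⟨u, hu⟩, fun ⟨u, hu⟩ => ⟨u, hb.req_lt u hu, hu⟩⟩
  have hans : σ₃.var vAns = σ.var vAns := by
    rw [hσ₃.var vAns rfl, hσ₂.var vAns rfl, hσ₁.var vAns rfl]
  refine .ite (fun ht => .skip ⟨hready, ?_⟩) fun ht => .setVar ⟨?_, ?_⟩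
  · rw [if_neg (hsucc.1 ht), hans]
  · exact ⟨hready.var_zero, hready.adj, hready.inp, hready.state⟩
  · rw [if_pos (not_not.1 (mt hsucc.2 ht))]
    rfl

/-- The effect of adding one on the binary digits. -/
theorem exists_testBit_succ (t : ℕ) : ∃ m, 2 ^ m ≤ t + 1 ∧ (∀ i < m, t.testBit i = true) ∧
    t.testBit m = false ∧
    ∀ i, (t + 1).testBit i = if i < m then false else if i = m then true else t.testBit i := by
  obtain ⟨m, b, ⟨a, rfl⟩, h⟩ := Nat.exists_eq_two_pow_mul_odd (Nat.succ_ne_zero t)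
  have hpos : 0 < 2 ^ m := by positivity
  have h0 : t = 2 ^ m * (2 * a) + (2 ^ m - 1) := by
    rw [Nat.succ_eq_add_one, Nat.mul_add] at h
    omega
  have h1 : t + 1 = 2 ^ m * (2 * a + 1) + 0 := h
  have ht : ∀ i, t.testBit i = if i < m then true else (2 * a).testBit (i - m) := fun i => by
    rw [h0, Nat.testBit_two_pow_mul_add _ (by omega)]
    split_ifs with hi
    · simp [Nat.testBit_two_pow_sub_one, hi]
    · rfl
  refine ⟨m, ?_, fun i hi => ?_, ?_, fun i => ?_⟩
  · rw [h1]
    exact Nat.le_mul_of_pos_right _ (Nat.succ_pos _)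
  · rw [ht, if_pos hi]
  · simp [ht]
  · rw [h1, Nat.testBit_two_pow_mul_add _ hpos]
    split_ifs with hi hi'
    · simp
    · simp [hi']
    · rw [ht, if_neg hi]
      obtain ⟨k, hk⟩ : ∃ k, i - m = k + 1 := ⟨i - m - 1, by omega⟩
      rw [hk, Nat.testBit_succ, Nat.testBit_succ]
      congr 1
      omega

theorem Run.increment {n t : ℕ} {σ : Store} (ht : t < 2 ^ n)
    (hσ : ∀ i, σ.arr aBits 0 i = (t.testBit i).toNat) :
    Run n increment (fun τ => ∀ i, τ.arr aBits 0 i = ((t + 1).testBit i).toNat) σ := by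
  obtain ⟨m, hm, h1, h2, h3⟩ := exists_testBit_succ t
  have hmn : m ≤ n := (Nat.pow_le_pow_iff_right (by norm_num)).1 (hm.trans ht)
  refine .seq (.setVar (.seq (Run.mono (Run.loop (m := m) (by omega)
    (fun k τ => τ.var vI = k ∧
      ∀ i, τ.arr aBits 0 i = if i < k then 0 else (t.testBit i).toNat) ?_ ?_ ?_) ?_)))
  · simpa [Store.setVar, Expr.eval] using hσ
  · rintro k hk τ ⟨hτk, hτ⟩
    refine ⟨by simp [hτk, hτ, h1 k hk], .seq (.setCell (.setVar ⟨?_, fun i => ?_⟩))⟩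
    · simp [Store.setVar, Store.setCell, Expr.eval, hτk]
    · simp only [Store.setVar, Store.setCell, Expr.eval, hτk, hτ, true_and]
      split_ifs <;> first | rfl | omega
  · rintro τ ⟨hτm, hτ⟩
    simp [hτm, hτ, h2]
  · rintro τ ⟨hτm, hτ⟩ -
    refine .setCell fun i => ?_
    simp only [Store.setCell, Expr.eval, hτm, hτ, true_and, h3]
    split_ifs <;> first | rfl | omega

theorem Run.bitLength (hn : σ.var 0 = n) (hl : σ.var vLen = 0) :
    Run n bitLength (fun τ => τ.var vLen = n / 3) σ := by
  refine .seq (.setVar (Run.mono (Run.loop (m := n / 3) (by omega)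
    (fun k τ => τ.var vRest = n - 3 * k ∧ τ.var vLen = k) ?_ ?_ ?_) fun τ h _ => h.2))
  · simp [Store.setVar, Expr.eval, hn, hl]
  · rintro k hk τ ⟨h1, h2⟩
    refine ⟨by simp only [Test.Holds, Expr.eval, h1]; omega, .seq (.setVar (.setVar ⟨?_, ?_⟩))⟩
    · simp only [Store.setVar, Expr.eval, h1, Nat.reduceEqDiff, if_true, if_false]
      omega
    · simp [Store.setVar, Expr.eval, h2]
  · rintro τ ⟨h1, -⟩
    simp only [Test.Holds, Expr.eval, h1]
    omega

open Classical in
/-- The program decides whether the search is successful for one of the `2 ^ (n / 3)` strings. -/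
theorem exec_extVCProg (G : SimpleGraph (Fin n)) (U : Set (Fin n)) :
    ∃ τ t, Exec extVCProg (input G U) τ t ∧
      t ≤ bitLength.bound n + (2 ^ (n / 3) *
        ((rowIs aBits vLen 0).cost + (Prog.seq trial increment).bound n) +
          (rowIs aBits vLen 0).cost + 2) ∧
      τ.var 0 = if ∃ k < 2 ^ (n / 3), Succeeds G U k.testBit then 1 else 0 := by
  have hi : ∀ a, a ≠ 0 → a ≠ 1 → ∀ i j, (input G U).arr a i j = 0 := fun a h0 h1 i j => by
    simp [input, h0, h1]
  obtain ⟨σ₁, t₁, he₁, ht₁, hl⟩ := Run.bitLength (n := n) (σ := input G U) rfl rfl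
  have hσ₁ := he₁.frame
  let Inv : ℕ → Store → Prop := fun k τ => Ready G U τ ∧ τ.var vLen = n / 3 ∧
    (∀ i, τ.arr aBits 0 i = (k.testBit i).toNat) ∧
    τ.var vAns = if ∃ k' < k, Succeeds G U k'.testBit then 1 else 0
  have h0 : Inv 0 σ₁ := by
    refine ⟨⟨hσ₁.var 0 rfl, hσ₁.arr aAdj rfl, hσ₁.arr aInput rfl, fun v _ => ?_⟩, hl,
      fun i => ?_, ?_⟩
    · rw [hσ₁.arr aState rfl, hi _ (by norm_num) (by norm_num)]
      norm_num
    · rw [hσ₁.arr aBits rfl, hi _ (by norm_num) (by norm_num)]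
      simp
    · rw [hσ₁.var vAns rfl]
      simp [input]
  have hstep : ∀ k < 2 ^ (n / 3), ∀ τ, Inv k τ → (rowIs aBits vLen 0).Holds τ ∧
      ∃ ρ t, Exec (.seq trial increment) τ ρ t ∧ t ≤ (Prog.seq trial increment).bound n ∧
        Inv (k + 1) ρ := by
    rintro k hk τ ⟨hr, hlen, hbits, hans⟩
    refine ⟨?_, ?_⟩
    · rw [holds_rowIs, hlen, hbits, Nat.testBit_lt_two_pow hk]
      rfl
    refine Run.seq ((Run.trial (β := k.testBit) hr fun i => ?_).mono ?_)
    · rw [hbits, Bool.toNat_eq_one]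
    rintro ρ ⟨hρr, hρans⟩ hρ
    refine (Run.increment (t := k) ?_ ?_).mono fun κ hκ hκf => ⟨?_, ?_, hκ, ?_⟩
    · exact hk.trans_le (Nat.pow_le_pow_right (by norm_num) (Nat.div_le_self n 3))
    · rw [hρ.arr aBits rfl]
      exact hbits
    · refine ⟨(hκf.var 0 rfl).trans hρr.var_zero, (hκf.arr aAdj rfl).trans hρr.adj,
        (hκf.arr aInput rfl).trans hρr.inp, ?_⟩
      rw [hκf.arr aState rfl]
      exact hρr.state
    · rw [hκf.var vLen rfl, hρ.var vLen rfl, hlen]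
    · have hsucc : (∃ k' < k + 1, Succeeds G U k'.testBit) ↔
          (∃ k' < k, Succeeds G U k'.testBit) ∨ Succeeds G U k.testBit := by
        simp only [Nat.lt_succ_iff_lt_or_eq, or_and_right, exists_or, exists_eq_left]
      rw [hκf.var vAns rfl, hρans, hans]
      simp only [hsucc]
      by_cases h : Succeeds G U k.testBit <;> simp [h]
  -- bit `n / 3` of the counter becomes `1` when all strings of that length have been tried
  have hend : ∀ τ, Inv (2 ^ (n / 3)) τ → ¬ (rowIs aBits vLen 0).Holds τ := by
    rintro τ ⟨-, hlen, hbits, -⟩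
    rw [holds_rowIs, hlen, hbits, Nat.testBit_two_pow_self]
    simp
  obtain ⟨σ₂, t₂, he₂, ht₂, hinv⟩ := Run.exists_exec_loop h0 hstep hend
  refine ⟨_, _, he₁.seq (he₂.seq (.setVar 0 (.var vAns) σ₂)), ?_, ?_⟩
  · simp only [Expr.cost]
    omega
  · simpa [Store.setVar, Expr.eval] using hinv.2.2.2

end Correctness

end RAM

theorem two_pow_div_three_le (n : ℕ) : (2 : ℝ) ^ (n / 3) ≤ (1.26 : ℝ) ^ n :=
  calc (2 : ℝ) ^ (n / 3) ≤ ((1.26 : ℝ) ^ 3) ^ (n / 3) := by gcongr; norm_num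
    _ = (1.26 : ℝ) ^ (3 * (n / 3)) := (pow_mul _ _ _).symm
    _ ≤ (1.26 : ℝ) ^ n := pow_le_pow_right₀ (by norm_num) (Nat.mul_div_le n 3)

theorem mainTheorem10 :
    ∃ (P : RAM.Prog) (p : Polynomial ℕ),
      ∀ (n : ℕ) (G : SimpleGraph (Fin n)) (U : Set (Fin n)), IsSubcubic G →
        ∃ (τ : RAM.Store) (t : ℕ),
          RAM.Exec P (RAM.input G U) τ t ∧
          (ExtVC G U → τ.var 0 = 1) ∧
          (¬ ExtVC G U → τ.var 0 = 0) ∧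
          (t : ℝ) ≤ ((p.eval n : ℕ) : ℝ) * (1.26 : ℝ) ^ n := by
  classical
  obtain ⟨p, hp⟩ := RAM.bitLength.exists_polynomial_bound
  obtain ⟨q, hq⟩ := (RAM.Prog.seq RAM.trial RAM.increment).exists_polynomial_bound
  set c := (RAM.rowIs 3 15 0).cost with hc
  refine ⟨RAM.extVCProg, p + (.C c + q) + .C (c + 2), fun n G U hG => ?_⟩
  obtain ⟨τ, t, he, ht, hans⟩ := RAM.exec_extVCProg G U
  have hiff : ExtVC G U ↔ ∃ k < 2 ^ (n / 3), RAM.Succeeds G U k.testBit :=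
    extVC_iff_solvable.trans
      (solvable_iff_exists_search (isSubcubic_map hG) domInstOf_bounded)
  refine ⟨τ, t, he, fun h => ?_, fun h => ?_, ?_⟩
  · rw [hans, if_pos (hiff.1 h)]
  · rw [hans, if_neg (mt hiff.2 h)]
  · have hle : t ≤ (p + (.C c + q) + .C (c + 2)).eval n * 2 ^ (n / 3) := by
      simp only [Polynomial.eval_add, Polynomial.eval_C]
      rw [hp, hq, ← hc] at ht
      have h1 : 1 ≤ 2 ^ (n / 3) := Nat.one_le_two_pow
      nlinarith [Nat.le_mul_of_pos_right (p.eval n) h1, Nat.le_mul_of_pos_right (c + 2) h1]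
    calc (t : ℝ) ≤ (((p + (.C c + q) + .C (c + 2)).eval n * 2 ^ (n / 3) : ℕ) : ℝ) := by
          exact_mod_cast hle
      _ = (((p + (.C c + q) + .C (c + 2)).eval n : ℕ) : ℝ) * (2 : ℝ) ^ (n / 3) := by
          push_cast
          rfl
      _ ≤ _ := by
          gcongr
          exact two_pow_div_three_le n
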